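/- Let $N\ge 0$ be an integer, let $T,L>0$, and let $V(x,s)$, $(x,s)\in\mathbb R^2$, be a jointly continuous potential with values in the Hermitian $N\times N$ matrices such that $V(x,s+T)=V(x,s)$ and $V(x+L,s)=V(x,s)$ (the periods need not be fundamental). Let $k>0$, and suppose that the Fermi level $\mu=k^2$ satisfies $\mu\notin\sigma(H(s))$ for all $s$, where $H(s)=-\frac{d^2}{dx^2}+V(\cdot,s)$ acts on $L^2(\mathbb R,\mathbb C^N)$ with domain $H^2(\mathbb R,\mathbb C^N)$. For a potential $U(x)$ and a truncation point $x_0$, consider the $C^1$ solutions $\psi:\mathbb R\to\mathbb C^N$ of $-\psi''(x)+\theta(x-x_0)U(x)\psi(x)=k^2\psi(x)$ (for $x\ne x_0$) that are $L^2$ at $+\infty$. For $x<x_0$ they have the form $\psi(x)=e^{ik(x-x_0)}\psi_R+e^{-ik(x-x_0)}\psi_L$. The reflection matrix of $U$ at $x_0$ is the matrix $R$ such that the pairs $(\psi_R,\psi_L)$ arising in this way are exactly those with $\psi_L=R\,\psi_R$. Let $R(x,s)$ be the reflection matrix of $V(\cdot,s)$ at the truncation point $x$. Let $v\in\mathbb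 R$, let $\hat V(\hat x,s)=V(\hat x+vs,s)$ be the potential in the frame $\hat x=x-vs$, and let $\hat R(\hat x,s)$ be the reflection matrix of $\hat V(\cdot,s)$ at $\hat x$. Suppose $n,m\in\mathbb Z$ satisfy $v\hat T=\hat L$, where $\hat T=nT$ and $\hat L=mL$. Then the reflection matrices $R(x,s)$, $\hat R(\hat x,s)$ exist (and are unique). Their determinants are continuous and zero-free, and the following winding numbers around $0$ are well defined (for a non-positive period $P$, the winding number is that of the path from $t$ to $t+P$): $W_x$ of $s\mapsto\det R(x,s)$ over the period $T$, $W_s$ of $x\mapsto\det R(x,s)$ over the period $L$, $\hat W_x$ of $s\mapsto\det\hat R(\hat x,s)$ over the period $nT$, and $\hat W_s$ of $\hat x\mapsto\det\hat R(\hat x,s)$ over the period $mL$. They do not depend on the point $x$, $s$, $\hat x$, $s$, respectively, that is held fixed. Moreover, $$\hat W_x=n\,W_x+m\,W_s,\qquad \hat W_s=m\,W_s .$$ -/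

import Mathlib

open MeasureTheory
open scoped ContDiff

noncomputable section

namespace QuantumPump

/-- The `N`-component Hilbert space `ℂ^N`. -/
abbrev Chan (N : ℕ) : Type := EuclideanSpace ℂ (Fin N)

/-- The Hilbert space `L²(ℝ, ℂ^N)`. -/
abbrev L2 (N : ℕ) : Type := Lp (Chan N) 2 (volume : Measure ℝ)

/-- The action of a square matrix on a column vector of `ℂ^N`. -/
def act {N : ℕ} (A : Matrix (Fin N) (Fin N) ℂ) (a : Chan N) : Chan N :=
  WithLp.toLp 2 (A.mulVec a.ofLp)

/-- `g ∈ L²` is the weak second derivative of `ψ ∈ L²`; that is, `ψ ∈ H²(ℝ, ℂ^N)` and `ψ'' = g`. -/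
def IsWeakSecondDeriv {N : ℕ} (ψ g : L2 N) : Prop :=
  ∀ φ : ℝ → ℂ, ContDiff ℝ ∞ φ → HasCompactSupport φ →
    ∫ x : ℝ, deriv (deriv φ) x • ψ x = ∫ x : ℝ, φ x • g x

/-- The graph of the operator `H = -d²/dx² + U(x)` on `L²(ℝ, ℂ^N)`: `ψ` belongs to the domain
(`ψ ∈ H²` and `-ψ'' + U ψ ∈ L²`) and `H ψ = f`.
For `U` bounded the domain is `H²(ℝ, ℂ^N)`. -/
def HamiltonianGraph {N : ℕ} (U : ℝ → Matrix (Fin N) (Fin N) ℂ) (ψ f : L2 N) : Prop :=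
  ∃ g : L2 N, IsWeakSecondDeriv ψ g ∧ ∀ᵐ x : ℝ, f x = -(g x) + act (U x) (ψ x)

/-- The spectrum of `H = -d²/dx² + U(x)`: the `z` for which `H - z` has no bounded, everywhere
defined inverse `G`, where `(H - z) ψ = f` means `H ψ = f + z ψ`. -/
def hamiltonianSpectrum {N : ℕ} (U : ℝ → Matrix (Fin N) (Fin N) ℂ) : Set ℂ :=
  {z | ¬ ∃ G : L2 N →L[ℂ] L2 N, ∀ ψ f : L2 N, HamiltonianGraph U ψ (f + z • ψ) ↔ ψ = G f}

/-- The potential truncated to `x ≥ x₀`, i.e. `θ(x - x₀) U(x)`. -/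
def truncate {N : ℕ} (U : ℝ → Matrix (Fin N) (Fin N) ℂ) (x₀ : ℝ) :
    ℝ → Matrix (Fin N) (Fin N) ℂ :=
  fun x => if x₀ ≤ x then U x else 0

/-- `ψ` is a `C¹` solution (the equation itself holding off the discontinuity `x₀`) of
`-ψ'' + θ(x - x₀) U(x) ψ = k² ψ`, it is `L²` at `+∞`, and to the left of the truncation point it is
the superposition of the incoming plane wave with amplitude `a` and the outgoing one with
amplitude `b`. -/
def IsScatteringState {N : ℕ} (U : ℝ → Matrix (Fin N) (Fin N) ℂ) (k x₀ : ℝ)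
    (a b : Chan N) (ψ : ℝ → Chan N) : Prop :=
  (∃ ψ' : ℝ → Chan N, Continuous ψ' ∧ (∀ x, HasDerivAt ψ (ψ' x) x) ∧
    ∀ x, x ≠ x₀ →
      HasDerivAt ψ' (act (truncate U x₀ x) (ψ x) - ((k : ℂ) ^ 2) • ψ x) x) ∧
  MemLp ψ 2 (volume.restrict (Set.Ioi x₀)) ∧
  ∀ x, x < x₀ → ψ x = Complex.exp (Complex.I * k * (x - x₀)) • a
    + Complex.exp (-(Complex.I * k * (x - x₀))) • b

/-- `R` is the reflection matrix, at energy `k²`, of the potential `U` truncated at `x₀`: the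
amplitudes `(a, b)` of scattering states are exactly the pairs with `b = R a`. -/
def IsReflectionMatrix {N : ℕ} (U : ℝ → Matrix (Fin N) (Fin N) ℂ) (k x₀ : ℝ)
    (R : Matrix (Fin N) (Fin N) ℂ) : Prop :=
  ∀ a b : Chan N, (∃ ψ, IsScatteringState U k x₀ a b ψ) ↔ b = act R a

/-- `f : ℝ → ℂ` is continuous, zero-free and `P`-periodic, and it winds `w` times around `0` when its
argument runs from `t` to `t + P` (backwards if `P < 0`): it has a continuous logarithm `ℓ` which
increases by `2πi w`. -/
def HasWindingNumber (f : ℝ → ℂ) (P : ℝ) (w : ℤ) : Prop :=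
  ∃ ℓ : ℝ → ℂ, Continuous ℓ ∧ (∀ t, f t = Complex.exp (ℓ t)) ∧
    ∀ t, ℓ (t + P) = ℓ t + 2 * Real.pi * Complex.I * w

/-- The potential in the frame `x̂ = x - v s`, i.e. `V̂(x̂, s) = V(x̂ + v s, s)`. -/
def boost {N : ℕ} (V : ℝ → ℝ → Matrix (Fin N) (Fin N) ℂ) (v : ℝ) :
    ℝ → ℝ → Matrix (Fin N) (Fin N) ℂ :=
  fun x s => V (x + v * s) s

/-- A truncated potential has at most one reflection matrix. -/
theorem IsReflectionMatrix.unique {N : ℕ} {U : ℝ → Matrix (Fin N) (Fin N) ℂ} {k x₀ : ℝ}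
    {R R' : Matrix (Fin N) (Fin N) ℂ} (h : IsReflectionMatrix U k x₀ R)
    (h' : IsReflectionMatrix U k x₀ R') : R = R' := by
  apply Matrix.mulVec_injective
  funext a
  have h1 := (h' (WithLp.toLp 2 a) _).1 ((h (WithLp.toLp 2 a) _).2 rfl)
  simpa [act] using h1

/-- A function has at most one winding number. -/
theorem HasWindingNumber.unique {f : ℝ → ℂ} {P : ℝ} {w w' : ℤ} (h : HasWindingNumber f P w)
    (h' : HasWindingNumber f P w') : w = w' := by
  obtain ⟨l, hl, hle, hlp⟩ := h
  obtain ⟨l', hl', hle', hlp'⟩ := h'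
  have hex : ∀ t, ∃ j : ℤ, l t = l' t + j * (2 * Real.pi * Complex.I) := fun t =>
    Complex.exp_eq_exp_iff_exists_int.1 ((hle t).symm.trans (hle' t))
  choose j hj using hex
  have hpi : (2 * Real.pi : ℝ) ≠ 0 := by positivity
  have hr : ∀ t, ((j t : ℤ) : ℝ) = (l t - l' t).im / (2 * Real.pi) := by
    intro t
    rw [hj t, eq_div_iff hpi]
    simp
  have hc : Continuous j := by
    rw [Int.isClosedEmbedding_coe_real.isInducing.continuous_iff]
    have : ((fun i : ℤ => (i : ℝ)) ∘ j) = fun t => (l t - l' t).im / (2 * Real.pi) := funext hr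
    rw [this]
    fun_prop
  have hconst : j P = j 0 := PreconnectedSpace.constant inferInstance hc
  have e1 := hlp 0
  have e2 := hlp' 0
  have e3 := hj P
  have e4 := hj 0
  rw [zero_add] at e1 e2
  rw [hconst] at e3
  have hne : (2 * Real.pi * Complex.I : ℂ) ≠ 0 := Complex.two_pi_I_ne_zero
  have : (2 * Real.pi * Complex.I : ℂ) * w = 2 * Real.pi * Complex.I * w' := by
    linear_combination e3 - e1 + e2 - e4
  exact_mod_cast mul_left_cancel₀ hne this

end QuantumPump

end

/-! Amplitudes (a, b) belong to a scattering state exactly when the Cauchy data `data k a b` at the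
truncation point evolve, under the full periodic equation, into a solution that is L² at +∞. This is
membership in the stable subspace of the transfer matrix over one period
(`exists_isScatteringState_iff`).

The flux Im⟨ψ, ψ'⟩ is conserved, hence zero on decaying data, so the subspaces decaying at +∞ and at
-∞ each have dimension at most N. The gap makes them span the 2N-dimensional phase space: a solution
is cut off and corrected by the resolvent (`IsPeriodicPotential.exists_split`). They are therefore
complementary, of dimension N each (`IsPeriodicPotential.isHyperbolic_translate`). A flux-free
subspace of dimension N is the graph of a norm-preserving matrix, the reflection matrix
(`exists_reflection_of_flux`). Since stable subspaces of hyperbolic maps vary with closed graph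
(`isClosed_stable_graph`) and R is norm-preserving, R is continuous in (x, s)
(`exists_continuous_reflection`).

The rest is topology of the plane. det R is continuous, zero-free and invariant under (L, 0) and (0,
T), so it has a continuous logarithm on ℝ² whose increments along these vectors are 2πi W_s and 2πi
W_x. In the moving frame the reflection matrix is R(x̂ + vs, s). By v·nT = mL, advancing s by nT
displaces the argument by (mL, nT), and advancing x̂ by mL displaces it by (mL, 0). Additivity of
the increments gives both laws. -/

noncomputable section

namespace QuantumPump

open Filter Topology

/-! ### Weak derivatives: the du Bois-Reymond lemma and regularity of H² functions. -/

section WeakDerivative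

theorem intervalIntegrable_of_locallyIntegrable {E : Type*} [NormedAddCommGroup E] {g : ℝ → E} (hg : LocallyIntegrable g) (a b : ℝ) :
    IntervalIntegrable g volume a b :=
  (hg.integrableOn_isCompact isCompact_uIcc).intervalIntegrable

variable {E : Type*} [NormedAddCommGroup E] [NormedSpace ℂ E]

/-- The primitive is started to the left of the support; the vanishing total integral makes it
vanish again to the right. -/
theorem exists_primitive_of_integral_eq_zero {φ : ℝ → ℂ} (h1 : ContDiff ℝ ∞ φ)
    (h2 : HasCompactSupport φ) (h0 : ∫ x, φ x = 0) :
    ∃ Φ : ℝ → ℂ, ContDiff ℝ ∞ Φ ∧ HasCompactSupport Φ ∧ deriv Φ = φ := by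
  obtain ⟨r, hr⟩ := h2.isBounded.subset_closedBall 0
  have hz : ∀ x, x ∉ Set.Ioc (-(|r| + 1)) (|r| + 1) → φ x = 0 := by
    intro x hx
    by_contra hne
    have h3 := hr (subset_tsupport _ (Function.mem_support.2 hne))
    rw [Metric.mem_closedBall, dist_zero_right, Real.norm_eq_abs] at h3
    have h4 := abs_le.1 (h3.trans (le_abs_self r))
    exact hx ⟨by linarith, by linarith⟩
  set b := |r| + 1 with hb
  have hbpos : 0 < b := by positivity
  have hd : ∀ x, HasDerivAt (fun x => ∫ y in (-b)..x, φ y) (φ x) x := fun x =>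
    (h1.continuous.integral_hasStrictDerivAt (-b) x).hasDerivAt
  have hder : deriv (fun x => ∫ y in (-b)..x, φ y) = φ := funext fun x => (hd x).deriv
  refine ⟨fun x => ∫ y in (-b)..x, φ y, ?_, ?_, hder⟩
  · rw [contDiff_infty_iff_deriv]
    exact ⟨fun x => (hd x).differentiableAt, by rw [hder]; exact h1⟩
  · refine HasCompactSupport.of_support_subset_isCompact (isCompact_Icc (a := -b) (b := b)) ?_
    intro x hx
    by_contra hx2
    refine hx ?_
    rw [Set.mem_Icc, not_and_or, not_le, not_le] at hx2
    rcases hx2 with hx2 | hx2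
    · refine (intervalIntegral.integral_congr (g := fun _ => 0) ?_).trans (by simp)
      intro y hy
      rw [Set.uIcc_of_ge hx2.le] at hy
      exact hz y fun h => absurd h.1 (not_lt.2 hy.2)
    · have h5 : ∫ y in (-b)..b, φ y = 0 := by
        rw [intervalIntegral.integral_of_le (by linarith), setIntegral_eq_integral_of_forall_compl_eq_zero hz, h0]
      change ∫ y in (-b)..x, φ y = 0
      rw [← intervalIntegral.integral_add_adjacent_intervals
        (h1.continuous.intervalIntegrable (-b) b) (h1.continuous.intervalIntegrable b x), h5, zero_add,
        intervalIntegral.integral_of_le hx2.le]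
      exact setIntegral_eq_zero_of_forall_eq_zero fun y hy => hz y fun h => absurd h.2 (not_le.2 hy.1)

/-- Subtracting (∫ φ) ρ from a test function φ leaves integral zero, hence a compactly supported
primitive that can itself serve as a test function. -/
theorem exists_test_integral_eq_one :
    ∃ ρ : ℝ → ℂ, ContDiff ℝ ∞ ρ ∧ HasCompactSupport ρ ∧ ∫ x, ρ x = 1 := by
  let f : ContDiffBump (0 : ℝ) := ⟨1, 2, by norm_num, by norm_num⟩
  refine ⟨fun x => (f.normed volume x : ℂ), ?_, ?_, ?_⟩
  · exact Complex.ofRealCLM.contDiff.comp f.contDiff_normed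
  · exact f.hasCompactSupport_normed.comp_left (g := ((↑) : ℝ → ℂ)) rfl
  · have h : ∫ x, ((f.normed volume x : ℝ) : ℂ) = ((∫ x, f.normed volume x : ℝ) : ℂ) := integral_ofReal
    rw [h, f.integral_normed, Complex.ofReal_one]

theorem integrable_test_smul {φ : ℝ → ℂ} (h1 : Continuous φ) (h2 : HasCompactSupport φ)
    {w : ℝ → E} (hw : LocallyIntegrable w) : Integrable fun x => φ x • w x :=
  hw.integrable_smul_left_of_hasCompactSupport h1 h2

theorem integrable_const_smul_test_smul {φ : ℝ → ℂ} (h1 : Continuous φ) (h2 : HasCompactSupport φ)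
    {w : ℝ → E} (hw : LocallyIntegrable w) (c : ℂ) : Integrable fun x => c • φ x • w x :=
  (integrable_test_smul h1 h2 hw).smul c

theorem contDiff_deriv_infty {φ : ℝ → ℂ} (h1 : ContDiff ℝ ∞ φ) : ContDiff ℝ ∞ (deriv φ) :=
  (contDiff_infty_iff_deriv.1 h1).2

/-- The increments of the vector-valued primitive are dominated by those of the scalar primitive of
‖g‖. -/
theorem absolutelyContinuous_primitive {g : ℝ → E} (hg : LocallyIntegrable g) {a b c : ℝ}
    (hc : c ∈ Set.uIcc a b) :
    AbsolutelyContinuousOnInterval (fun x => ∫ y in c..x, g y) a b := by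
  have hi : ∀ x y, IntervalIntegrable g volume x y := intervalIntegrable_of_locallyIntegrable hg
  have h := (hi a b).norm.absolutelyContinuousOnInterval_intervalIntegral hc
  refine squeeze_zero (fun t => Finset.sum_nonneg fun i _ => dist_nonneg) (fun t => ?_) h
  refine Finset.sum_le_sum fun i _ => ?_
  rw [dist_eq_norm, dist_eq_norm, intervalIntegral.integral_interval_sub_left (hi _ _) (hi _ _),
    intervalIntegral.integral_interval_sub_left (hi _ _).norm (hi _ _).norm, Real.norm_eq_abs]
  exact intervalIntegral.norm_integral_le_abs_integral_norm

variable [CompleteSpace E]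

/-- A first-order du Bois-Reymond lemma for functions tested against second derivatives. -/
theorem exists_const_of_weak_deriv_deriv {w g : ℝ → E} (hw : LocallyIntegrable w)
    (hg : LocallyIntegrable g)
    (h : ∀ φ : ℝ → ℂ, ContDiff ℝ ∞ φ → HasCompactSupport φ →
      ∫ x, deriv (deriv φ) x • w x = -∫ x, deriv φ x • g x) :
    ∃ C : E, ∀ φ : ℝ → ℂ, ContDiff ℝ ∞ φ → HasCompactSupport φ →
      ∫ x, deriv φ x • w x = -∫ x, φ x • (g x + C) := by
  obtain ⟨ρ, hρ1, hρ2, hρ⟩ := exists_test_integral_eq_one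
  have hlin : ∀ φ : ℝ → ℂ, ContDiff ℝ ∞ φ → HasCompactSupport φ →
      Integrable (fun x => deriv φ x • w x) ∧ Integrable (fun x => φ x • g x) := fun φ h1 h2 =>
    ⟨integrable_test_smul (contDiff_deriv_infty h1).continuous h2.deriv hw,
      integrable_test_smul h1.continuous h2 hg⟩
  -- Testing with the primitive χ of φ - cρ, c = ∫ φ, gives the identity for φ up to the term c • D
  -- contributed by ρ; the constant -D absorbs it.
  refine ⟨-((∫ x, deriv ρ x • w x) + ∫ x, ρ x • g x), fun φ h1 h2 => ?_⟩
  set D := (∫ x, deriv ρ x • w x) + ∫ x, ρ x • g x with hD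
  set c := ∫ x, φ x with hc
  have hi1 : Integrable φ := h1.continuous.integrable_of_hasCompactSupport h2
  have hi2 : Integrable ρ := hρ1.continuous.integrable_of_hasCompactSupport hρ2
  obtain ⟨χ, hχ1, hχ2, hχ⟩ := exists_primitive_of_integral_eq_zero (φ := fun x => φ x - c * ρ x)
    (h1.sub (contDiff_const.mul hρ1)) (h2.sub (hρ2.mul_left (f := fun _ => c))) (by
      rw [integral_sub hi1 (hi2.const_mul c), integral_const_mul, hρ, mul_one, sub_self])
  have hχχ : deriv (deriv χ) = fun x => deriv φ x - c * deriv ρ x := by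
    rw [hχ]
    funext x
    have e1 := ((h1.differentiable (by simp)) x).hasDerivAt
    have e2 := ((hρ1.differentiable (by simp)) x).hasDerivAt
    exact (e1.sub (e2.const_mul c)).deriv
  have key := h χ hχ1 hχ2
  rw [hχχ, hχ] at key
  simp only [sub_smul, mul_smul] at key
  rw [integral_sub (hlin φ h1 h2).1 (integrable_const_smul_test_smul (contDiff_deriv_infty hρ1).continuous hρ2.deriv hw c),
    integral_sub (hlin φ h1 h2).2 (integrable_const_smul_test_smul hρ1.continuous hρ2 hg c), integral_smul, integral_smul] at key
  have e3 : ∫ x, φ x • (g x + -D) = (∫ x, φ x • g x) - c • D := by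
    simp only [smul_add, smul_neg]
    rw [integral_add (hlin φ h1 h2).2 (show Integrable fun x => -(φ x • D) from (hi1.smul_const D).neg),
      integral_neg, integral_smul_const, ← sub_eq_add_neg]
  rw [e3, hD, eq_add_of_sub_eq key]
  module

theorem ae_eq_const_of_weak_deriv_eq_zero {w : ℝ → E} (hw : LocallyIntegrable w)
    (h : ∀ φ : ℝ → ℂ, ContDiff ℝ ∞ φ → HasCompactSupport φ → ∫ x, deriv φ x • w x = 0) :
    ∃ C : E, ∀ᵐ x, w x = C := by
  obtain ⟨ρ, hρ1, hρ2, hρ⟩ := exists_test_integral_eq_one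
  refine ⟨∫ x, ρ x • w x, ae_eq_of_integral_contDiff_smul_eq hw
    (locallyIntegrable_const _) fun f hf1 hf2 => ?_⟩
  have h1 : ContDiff ℝ ∞ fun x => (f x : ℂ) := Complex.ofRealCLM.contDiff.comp hf1
  have h2 : HasCompactSupport fun x => (f x : ℂ) := hf2.comp_left (g := ((↑) : ℝ → ℂ)) rfl
  set c := ∫ x, (f x : ℂ) with hc
  have hi1 : Integrable fun x => (f x : ℂ) := h1.continuous.integrable_of_hasCompactSupport h2
  have hi2 : Integrable ρ := hρ1.continuous.integrable_of_hasCompactSupport hρ2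
  obtain ⟨χ, hχ1, hχ2, hχ⟩ := exists_primitive_of_integral_eq_zero
    (φ := fun x => (f x : ℂ) - c * ρ x)
    (h1.sub (contDiff_const.mul hρ1)) (h2.sub (hρ2.mul_left (f := fun _ => c))) (by
      rw [integral_sub hi1 (hi2.const_mul c), integral_const_mul, hρ, mul_one, sub_self])
  have key := h χ hχ1 hχ2
  rw [hχ] at key
  simp only [sub_smul, mul_smul] at key
  rw [integral_sub (integrable_test_smul h1.continuous h2 hw)
    (integrable_const_smul_test_smul hρ1.continuous hρ2 hw c), integral_smul, sub_eq_zero] at key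
  have e1 : ∀ (x : ℝ) (y : E), f x • y = (f x : ℂ) • y := fun x y => (Complex.coe_smul _ _).symm
  simp only [e1]
  rw [key, integral_smul_const]

/-- Integration by parts against a test function. -/
theorem integral_deriv_smul_primitive {g : ℝ → E} (hg : LocallyIntegrable g) {φ : ℝ → ℂ}
    (h1 : ContDiff ℝ ∞ φ) (h2 : HasCompactSupport φ) :
    ∫ x, deriv φ x • (∫ y in (0 : ℝ)..x, g y) = -∫ x, φ x • g x := by
  have hi : ∀ x y, IntervalIntegrable g volume x y := intervalIntegrable_of_locallyIntegrable hg
  set P : ℝ → E := fun x => ∫ y in (0 : ℝ)..x, g y with hP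
  have hPc : Continuous P := intervalIntegral.continuous_primitive hi 0
  have hl1 : LocallyIntegrable fun x => deriv φ x • P x :=
    ((contDiff_deriv_infty h1).continuous.smul hPc).locallyIntegrable
  have hI1 := integrable_test_smul (contDiff_deriv_infty h1).continuous h2.deriv
    hPc.locallyIntegrable
  have hI2 := integrable_test_smul h1.continuous h2 hg
  obtain ⟨r, hr⟩ := h2.isBounded.subset_closedBall 0
  have hz' : ∀ x, x ∉ Set.Ioo (-(|r| + 1)) (|r| + 1) → x ∉ tsupport φ := by
    intro x hx hne
    have h3 := hr hne
    rw [Metric.mem_closedBall, dist_zero_right, Real.norm_eq_abs] at h3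
    have h4 := abs_le.1 (h3.trans (le_abs_self r))
    exact hx ⟨by linarith, by linarith⟩
  set b := |r| + 1 with hb
  have hbpos : 0 < b := by positivity
  have hz : ∀ x, x ∉ Set.Ioo (-b) b → φ x = 0 := fun x hx => image_eq_zero_of_notMem_tsupport (hz' x hx)
  have hzd : ∀ x, x ∉ Set.Ioo (-b) b → deriv φ x = 0 := fun x hx =>
    Function.notMem_support.1 fun h => hz' x hx (support_deriv_subset h)
  have h0 : (0 : ℝ) ∈ Set.uIcc (-b) b := by
    rw [Set.uIcc_of_le (by linarith)]; exact ⟨by linarith, hbpos.le⟩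
  have hm : -b ∈ Set.uIcc (-b) b := Set.left_mem_uIcc
  -- φ P minus the primitive of φ' P + φ g is absolutely continuous with derivative zero almost
  -- everywhere, hence constant. Comparing its values at ±b, where φ vanishes, gives the claim.
  have hAC := (((h1.of_le (by simp)).contDiffOn.absolutelyContinuousOnInterval (a := -b)
    (b := b)).smul (absolutelyContinuous_primitive hg h0)).sub
      ((absolutelyContinuous_primitive (hI1.locallyIntegrable.add hI2.locallyIntegrable) hm))
  obtain ⟨C, hC⟩ := hAC.const_of_ae_hasDerivAt_zero (by
    filter_upwards [LocallyIntegrable.ae_hasDerivAt_integral hg,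
      LocallyIntegrable.ae_hasDerivAt_integral (hI1.locallyIntegrable.add hI2.locallyIntegrable)] with x hx1 hx2 _
    have e1 := ((h1.differentiable (by simp)) x).hasDerivAt
    have e2 := (e1.smul (hx1 0)).sub (hx2 (-b))
    convert e2 using 1
    simp [hP]
    abel)
  have hA := hC (-b) hm
  have hB := hC b Set.right_mem_uIcc
  have e1 : φ (-b) = 0 := hz _ (by simp)
  have e2 : φ b = 0 := hz _ (by simp)
  simp only [Pi.sub_apply, Pi.smul_apply', e1, e2, zero_smul, intervalIntegral.integral_same, sub_zero, zero_sub,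
    Pi.add_apply] at hA hB
  rw [← hA, neg_eq_zero, intervalIntegral.integral_of_le (by linarith),
    setIntegral_eq_integral_of_forall_compl_eq_zero, integral_add hI1 hI2] at hB
  · exact eq_neg_of_add_eq_zero_left hB
  · intro x hx
    have : x ∉ Set.Ioo (-b) b := fun h => hx ⟨h.1, h.2.le⟩
    simp [hz x this, hzd x this]

/-- A locally integrable function with a locally integrable weak second derivative. -/
theorem ae_eq_of_weak_second_deriv {w g : ℝ → E} (hw : LocallyIntegrable w)
    (hg : LocallyIntegrable g)
    (h : ∀ φ : ℝ → ℂ, ContDiff ℝ ∞ φ → HasCompactSupport φ →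
      ∫ x, deriv (deriv φ) x • w x = ∫ x, φ x • g x) :
    ∃ C D : E, ∀ᵐ x, w x = D + ∫ y in (0 : ℝ)..x, (C + ∫ t in (0 : ℝ)..y, g t) := by
  have hPc : Continuous fun x => ∫ y in (0 : ℝ)..x, g y :=
    intervalIntegral.continuous_primitive (intervalIntegrable_of_locallyIntegrable hg) 0
  obtain ⟨C, hC⟩ := exists_const_of_weak_deriv_deriv hw hPc.locallyIntegrable fun φ h1 h2 => by
    rw [h φ h1 h2, integral_deriv_smul_primitive hg h1 h2, neg_neg]
  have hc2 : Continuous fun x => C + ∫ y in (0 : ℝ)..x, g y := continuous_const.add hPc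
  have hc3 : Continuous fun x => ∫ y in (0 : ℝ)..x, (C + ∫ t in (0 : ℝ)..y, g t) :=
    intervalIntegral.continuous_primitive (fun x y => hc2.intervalIntegrable x y) 0
  obtain ⟨D, hD⟩ := ae_eq_const_of_weak_deriv_eq_zero (hw.sub hc3.locallyIntegrable)
    fun φ h1 h2 => by
      have e1 := integrable_test_smul (contDiff_deriv_infty h1).continuous h2.deriv hw
      have e2 := integrable_test_smul (contDiff_deriv_infty h1).continuous h2.deriv
        hc3.locallyIntegrable
      simp only [Pi.sub_apply, smul_sub]
      rw [integral_sub e1 e2, integral_deriv_smul_primitive hc2.locallyIntegrable h1 h2,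
        hC φ h1 h2]
      simp only [add_comm C, sub_self]
  refine ⟨C, D, ?_⟩
  filter_upwards [hD] with x hx
  rw [← hx]
  simp

end WeakDerivative

/-! ### Linear equations in a Banach algebra: the Dyson series. -/

theorem summable_dyson_bound (c K r : ℝ) :
    Summable fun n : ℕ => c * ((K * r) ^ n / n.factorial) :=
  (Real.summable_pow_div_factorial _).mul_left _

section LinearODE

variable {B : Type*} [NormedRing B] [NormedAlgebra ℝ B]

/-- The terms of the Dyson series of the linear equation `Y' = A Y`, `Y 0 = 1`. -/
def dyson (A : ℝ → B) : ℕ → ℝ → B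
  | 0 => fun _ => 1
  | n + 1 => fun t => ∫ τ in (0 : ℝ)..t, A τ * dyson A n τ

/-- The solution of `Y' = A Y`, `Y 0 = 1`. -/
def propagator (A : ℝ → B) (t : ℝ) : B := ∑' n, dyson A n t

theorem continuous_dyson {X : Type*} [TopologicalSpace X] [FirstCountableTopology X]
    {A : X → ℝ → B}
    (hA : Continuous fun p : X × ℝ => A p.1 p.2) (n : ℕ) :
    Continuous fun p : X × ℝ => dyson (A p.1) n p.2 := by
  induction n with
  | zero => exact continuous_const
  | succ n ih =>
    have h : Continuous (Function.uncurry fun (p : X × ℝ) (τ : ℝ) =>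
        A p.1 τ * dyson (A p.1) n τ) :=
      (hA.comp ((continuous_fst.comp continuous_fst).prodMk continuous_snd)).mul
        (ih.comp ((continuous_fst.comp continuous_fst).prodMk continuous_snd))
    exact intervalIntegral.continuous_parametric_intervalIntegral_of_continuous h continuous_snd

theorem continuous_dyson_right {A : ℝ → B} (hA : Continuous A) (n : ℕ) :
    Continuous (dyson A n) :=
  (continuous_dyson (X := Unit) (A := fun _ => A) (hA.comp continuous_snd) n).comp
    (continuous_const (y := ()) |>.prodMk continuous_id)

/-- Each integration of |τ|^n brings a factor 1/(n + 1), whence the factorial. The factor ‖1‖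
remains because it need not equal 1: operators on the trivial space (N = 0) have ‖1‖ = 0. -/
theorem norm_dyson_le {A : ℝ → B} (hA : Continuous A) {K : ℝ} (hK : ∀ t, ‖A t‖ ≤ K) (n : ℕ)
    (t : ℝ) : ‖dyson A n t‖ ≤ ‖(1 : B)‖ * ((K * |t|) ^ n / n.factorial) := by
  have hK0 : 0 ≤ K := (norm_nonneg _).trans (hK 0)
  induction n generalizing t with
  | zero => simp [dyson]
  | succ n ih =>
    have hb : ∀ τ, ‖A τ * dyson A n τ‖ ≤ ‖(1 : B)‖ * K ^ (n + 1) / n.factorial * |τ - 0| ^ n := by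
      intro τ
      calc ‖A τ * dyson A n τ‖ ≤ ‖A τ‖ * ‖dyson A n τ‖ := norm_mul_le _ _
        _ ≤ K * (‖(1 : B)‖ * ((K * |τ|) ^ n / n.factorial)) :=
          mul_le_mul (hK τ) (ih τ) (norm_nonneg _) hK0
        _ = _ := by rw [sub_zero]; ring
    have hc : Continuous fun τ => A τ * dyson A n τ := hA.mul (continuous_dyson_right hA n)
    calc ‖dyson A (n + 1) t‖ ≤ ∫ τ in Set.uIoc 0 t, ‖A τ * dyson A n τ‖ :=
          intervalIntegral.norm_integral_le_integral_norm_uIoc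
      _ ≤ ∫ τ in Set.uIoc 0 t, ‖(1 : B)‖ * K ^ (n + 1) / n.factorial * |τ - 0| ^ n := by
          refine setIntegral_mono ?_ ?_ hb
          · exact (hc.norm.intervalIntegrable 0 t).def'
          · exact ((by fun_prop : Continuous fun τ : ℝ =>
              ‖(1 : B)‖ * K ^ (n + 1) / n.factorial * |τ - 0| ^ n).intervalIntegrable 0 t).def'
      _ = _ := by
          rw [integral_const_mul, integral_pow_abs_sub_uIoc, sub_zero, Nat.factorial_succ]
          push_cast
          rw [mul_pow]
          field_simp

theorem norm_dyson_le_of_abs_le {A : ℝ → B} (hA : Continuous A) {K : ℝ} (hK : ∀ t, ‖A t‖ ≤ K)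
    {r t : ℝ} (ht : |t| ≤ r) (n : ℕ) :
    ‖dyson A n t‖ ≤ ‖(1 : B)‖ * ((K * r) ^ n / n.factorial) := by
  have hK0 : 0 ≤ K := (norm_nonneg _).trans (hK 0)
  refine (norm_dyson_le hA hK n t).trans ?_
  gcongr

theorem propagator_zero (A : ℝ → B) : propagator A 0 = 1 := by
  rw [propagator, tsum_eq_single 0]
  · rfl
  · intro n hn
    obtain ⟨m, rfl⟩ := Nat.exists_eq_succ_of_ne_zero hn
    simp [dyson]

variable [CompleteSpace B]

theorem continuous_propagator {X : Type*} [TopologicalSpace X] [FirstCountableTopology X]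
    {A : X → ℝ → B}
    (hA : Continuous fun p : X × ℝ => A p.1 p.2) {K : ℝ} (hK : ∀ x t, ‖A x t‖ ≤ K) :
    Continuous fun p : X × ℝ => propagator (A p.1) p.2 := by
  refine continuous_iff_continuousAt.2 fun p => ?_
  have ho : IsOpen {q : X × ℝ | |q.2| < |p.2| + 1} :=
    isOpen_lt (by fun_prop) continuous_const
  -- On the open strip |t| < |p.2| + 1 the series converges uniformly, by the Weierstrass test.
  refine ContinuousOn.continuousAt (s := {q : X × ℝ | |q.2| < |p.2| + 1}) ?_
    (ho.mem_nhds (by simp))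
  refine continuousOn_tsum (fun n => (continuous_dyson hA n).continuousOn)
    (summable_dyson_bound ‖(1 : B)‖ K (|p.2| + 1)) fun n q hq => ?_
  exact norm_dyson_le_of_abs_le (hA.comp (continuous_const.prodMk continuous_id)) (hK q.1)
    (le_of_lt hq) n

theorem hasDerivAt_propagator {A : ℝ → B} (hA : Continuous A) {K : ℝ} (hK : ∀ t, ‖A t‖ ≤ K)
    (t : ℝ) : HasDerivAt (propagator A) (A t * propagator A t) t := by
  have hK0 : 0 ≤ K := (norm_nonneg _).trans (hK 0)
  set r := |t| + 1 with hr
  -- Termwise derivatives: zero for the constant term, and A times term m for term m + 1; `u` is a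
  -- summable majorant on the ball.
  let g' : ℕ → ℝ → B := fun n y => Nat.casesOn n 0 fun m => A y * dyson A m y
  let u : ℕ → ℝ := fun n =>
    Nat.casesOn n 0 fun m => K * (‖(1 : B)‖ * ((K * r) ^ m / m.factorial))
  have hs : Summable u := (summable_nat_add_iff 1).1 ((summable_dyson_bound _ K r).mul_left K)
  have habs : ∀ y ∈ Metric.ball (0 : ℝ) r, |y| ≤ r := fun y hy => by
    rw [mem_ball_zero_iff, Real.norm_eq_abs] at hy
    exact hy.le
  have ht : t ∈ Metric.ball (0 : ℝ) r := by
    rw [mem_ball_zero_iff, Real.norm_eq_abs]; linarith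
  have hsum : Summable fun n => dyson A n t :=
    Summable.of_norm_bounded (summable_dyson_bound _ K r)
      fun n => norm_dyson_le_of_abs_le hA hK (habs t ht) n
  have h := hasDerivAt_tsum_of_isPreconnected (g := fun n => dyson A n) (g' := g') (u := u) hs
    Metric.isOpen_ball (convex_ball (0 : ℝ) r).isPreconnected
    (fun n y hy => by
      cases n with
      | zero => exact hasDerivAt_const y (1 : B)
      | succ m =>
        exact ((hA.mul (continuous_dyson_right hA m)).integral_hasStrictDerivAt 0 y).hasDerivAt)
    (fun n y hy => by
      cases n with
      | zero => simp [g', u]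
      | succ m =>
        exact (norm_mul_le _ _).trans (mul_le_mul (hK y)
          (norm_dyson_le_of_abs_le hA hK (habs y hy) m) (norm_nonneg _) hK0))
    ht hsum ht
  have hg : ∑' n, g' n t = A t * propagator A t := by
    have hs' : Summable fun n => g' n t := by
      rw [← summable_nat_add_iff 1]
      exact hsum.mul_left (A t)
    rw [hs'.tsum_eq_zero_add]
    exact (zero_add _).trans (hsum.tsum_mul_left (A t))
  rw [hg] at h
  exact h

end LinearODE

/-! ### Uniqueness of the flow and its factorization over periods. -/

section LinearFlow

variable {F : Type*} [NormedAddCommGroup F] [NormedSpace ℂ F] [CompleteSpace F]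

theorem hasDerivAt_propagator_apply {A : ℝ → F →L[ℂ] F} (hA : Continuous A) {K : ℝ}
    (hK : ∀ t, ‖A t‖ ≤ K) (z : F) (t : ℝ) :
    HasDerivAt (fun y => propagator A y z) (A t (propagator A t z)) t :=
  (((ContinuousLinearMap.apply ℂ F z).restrictScalars ℝ).hasFDerivAt.comp_hasDerivAt t
    (hasDerivAt_propagator hA hK t))

theorem eq_propagator_apply {A : ℝ → F →L[ℂ] F} (hA : Continuous A) {K : ℝ}
    (hK : ∀ t, ‖A t‖ ≤ K) {z : ℝ → F} (hz : ∀ t, HasDerivAt z (A t (z t)) t) (t : ℝ) :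
    z t = propagator A t (z 0) := by
  have hl : ∀ t, LipschitzOnWith K.toNNReal (fun w : F => A t w) Set.univ := fun t =>
    ((A t).lipschitz.weaken (by
      rw [← NNReal.coe_le_coe, coe_nnnorm]
      exact (hK t).trans (Real.le_coe_toNNReal K))).lipschitzOnWith
  have h := ODE_solution_unique_univ (t₀ := 0) (v := fun t w => A t w) hl
    (fun t => ⟨hz t, trivial⟩)
    (fun t => ⟨hasDerivAt_propagator_apply hA hK (z 0) t, trivial⟩) (by simp [propagator_zero])
  exact congrFun h t

/-- By periodicity the translate by L of a solution solves the same equation, so uniqueness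
identifies it from its value at 0. -/
theorem propagator_add_period {A : ℝ → F →L[ℂ] F} (hA : Continuous A) {K : ℝ}
    (hK : ∀ t, ‖A t‖ ≤ K) {L : ℝ} (hL : ∀ t, A (t + L) = A t) (t : ℝ) :
    propagator A (t + L) = propagator A t * propagator A L := by
  ext z
  have h := eq_propagator_apply hA hK (z := fun t => propagator A (t + L) z) (fun t => by
    have := (hasDerivAt_propagator_apply hA hK z (t + L)).comp_add_const t L
    rwa [hL] at this) t
  rwa [zero_add] at h

theorem propagator_neg_period_mul {A : ℝ → F →L[ℂ] F} (hA : Continuous A) {K : ℝ}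
    (hK : ∀ t, ‖A t‖ ≤ K) {L : ℝ} (hL : ∀ t, A (t + L) = A t) :
    propagator A (-L) * propagator A L = 1 := by
  rw [← propagator_add_period hA hK hL, neg_add_cancel, propagator_zero]

theorem propagator_period_mul_neg {A : ℝ → F →L[ℂ] F} (hA : Continuous A) {K : ℝ}
    (hK : ∀ t, ‖A t‖ ≤ K) {L : ℝ} (hL : ∀ t, A (t + L) = A t) :
    propagator A L * propagator A (-L) = 1 := by
  have hL' : ∀ t, A (t + -L) = A t := fun t => by rw [← hL (t + -L), neg_add_cancel_right]
  rw [← propagator_add_period hA hK hL', add_neg_cancel, propagator_zero]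

theorem propagator_add_nat_mul_period {A : ℝ → F →L[ℂ] F} (hA : Continuous A) {K : ℝ}
    (hK : ∀ t, ‖A t‖ ≤ K) {L : ℝ} (hL : ∀ t, A (t + L) = A t) (t : ℝ) (j : ℕ) :
    propagator A (t + j * L) = propagator A t * propagator A L ^ j := by
  induction j with
  | zero => simp
  | succ j ih =>
    rw [Nat.cast_succ, add_mul, one_mul, ← add_assoc, propagator_add_period hA hK hL, ih, pow_succ,
      mul_assoc]

end LinearFlow

/-! ### Stable subspaces of hyperbolic linear maps. -/

section Dichotomy

variable {F : Type*} [NormedAddCommGroup F] [NormedSpace ℂ F]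

/-- The vectors contracted to `0` by the iterates of `M`. -/
def stable (M : F →L[ℂ] F) : Submodule ℂ F where
  carrier := {z | Tendsto (fun j : ℕ => (M ^ j) z) atTop (𝓝 0)}
  zero_mem' := by simp
  add_mem' {a b} ha hb := by
    have := Tendsto.add ha hb
    simpa using this
  smul_mem' c a ha := by
    have := Tendsto.const_smul ha c
    simpa only [Set.mem_ofPred_eq, map_smul, smul_zero] using this

theorem mem_stable {M : F →L[ℂ] F} {z : F} :
    z ∈ stable M ↔ Tendsto (fun j : ℕ => (M ^ j) z) atTop (𝓝 0) := Iff.rfl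

theorem apply_mem_stable {M M' : F →L[ℂ] F} (h : Commute M' M) {z : F} (hz : z ∈ stable M) :
    M' z ∈ stable M := by
  have h1 := (M'.continuous.tendsto 0).comp (mem_stable.1 hz)
  rw [map_zero] at h1
  refine h1.congr fun j => ?_
  exact congrArg (fun A : F →L[ℂ] F => A z) (h.pow_right j).eq

variable [FiniteDimensional ℂ F]

theorem tendsto_norm_zero_of_pointwise {A : ℕ → F →L[ℂ] F}
    (h : ∀ z, Tendsto (fun j => A j z) atTop (𝓝 0)) : Tendsto (fun j => ‖A j‖) atTop (𝓝 0) := by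
  let b := Module.finBasis ℂ F
  obtain ⟨C, hC, hb⟩ := b.exists_opNorm_le (F := F)
  have h1 : Tendsto (fun j => C * ∑ i, ‖A j (b i)‖) atTop (𝓝 0) := by
    have := (tendsto_finsetSum Finset.univ fun i _ => (h (b i)).norm).const_mul C
    simpa using this
  refine squeeze_zero (fun j => norm_nonneg _) (fun j => ?_) h1
  exact hb (Finset.sum_nonneg fun i _ => norm_nonneg _) fun i =>
    Finset.single_le_sum (f := fun i => ‖A j (b i)‖) (fun i _ => norm_nonneg _) (Finset.mem_univ i)

/-- The spectral projection of a hyperbolic map onto its stable subspace. -/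
theorem exists_stable_projection {M M' : F →L[ℂ] F} (h1 : M * M' = 1) (h2 : M' * M = 1)
    (hd : Disjoint (stable M) (stable M')) (hs : stable M ⊔ stable M' = ⊤) :
    ∃ P : F →L[ℂ] F, (∀ z, P z ∈ stable M) ∧ (∀ z, z - P z ∈ stable M') ∧ Commute P M := by
  have hc : IsCompl (stable M) (stable M') := ⟨hd, codisjoint_iff.2 hs⟩
  have hMM : Commute M M' := h1.trans h2.symm
  let P : F →L[ℂ] F :=
    LinearMap.toContinuousLinearMap ((stable M).subtype ∘ₗ (stable M).projectionOnto _ hc)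
  have hP1 : ∀ z, P z ∈ stable M := fun z => ((stable M).projectionOnto _ hc z).2
  have hPs : ∀ z ∈ stable M, P z = z := fun z hz =>
    congrArg Subtype.val (Submodule.projectionOnto_apply_left hc ⟨z, hz⟩)
  have hPu : ∀ z ∈ stable M', P z = 0 := fun z hz =>
    congrArg Subtype.val (Submodule.projectionOnto_apply_right hc ⟨z, hz⟩)
  have hP2 : ∀ z, z - P z ∈ stable M' := by
    intro z
    obtain ⟨a, ha, b, hb, rfl⟩ := Submodule.mem_sup.1 (hs ▸ Submodule.mem_top : z ∈ stable M ⊔ stable M')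
    rw [map_add, hPs a ha, hPu b hb]
    simpa using hb
  refine ⟨P, hP1, hP2, ?_⟩
  ext z
  have e : z = P z + (z - P z) := by abel
  change P (M z) = M (P z)
  conv_lhs => rw [e]
  rw [map_add, map_add, hPs _ (apply_mem_stable (Commute.refl M) (hP1 z)),
    hPu _ (apply_mem_stable hMM (hP2 z)), add_zero]

/-- The stable subspaces of a continuous family of hyperbolic maps form a closed set. The proof uses
that a cone around the unstable subspace of one map is invariant under the nearby ones. -/
theorem isClosed_stable_graph {X : Type*} [TopologicalSpace X] {M M' : X → F →L[ℂ] F}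
    (hM : Continuous M) (h1 : ∀ x, M x * M' x = 1) (h2 : ∀ x, M' x * M x = 1)
    (hd : ∀ x, Disjoint (stable (M x)) (stable (M' x)))
    (hs : ∀ x, stable (M x) ⊔ stable (M' x) = ⊤) :
    IsClosed {p : X × F | p.2 ∈ stable (M p.1)} := by
  rw [← isOpen_compl_iff, isOpen_iff_mem_nhds]
  rintro ⟨x, z⟩ hz
  obtain ⟨P, hP1, hP2, hPM⟩ := exists_stable_projection (h1 x) (h2 x) (hd x) (hs x)
  have hMM : Commute (M x) (M' x) := (h1 x).trans (h2 x).symm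
  set Q : F →L[ℂ] F := 1 - P with hQ
  have hQM : Commute Q (M x) := (Commute.one_left _).sub_left hPM
  have hQz : Q z ≠ 0 := by
    intro h
    apply hz
    have : z = P z := sub_eq_zero.1 h
    change z ∈ stable (M x)
    rw [this]; exact hP1 z
  have hQpos : 0 < ‖Q z‖ := norm_pos_iff.2 hQz
  -- the cone parameter
  obtain ⟨ε, hε, hε1, hεz⟩ : ∃ ε : ℝ, 0 < ε ∧ ε ≤ 1 ∧ ε * ‖P z‖ < ‖Q z‖ := by
    refine ⟨min 1 (‖Q z‖ / (‖P z‖ + 1)), by positivity, min_le_left _ _, ?_⟩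
    calc _ ≤ ‖Q z‖ / (‖P z‖ + 1) * ‖P z‖ := by gcongr; exact min_le_right _ _
      _ < ‖Q z‖ := by
        rw [div_mul_eq_mul_div, div_lt_iff₀ (by positivity)]
        nlinarith [norm_nonneg (P z)]
  have hA := tendsto_norm_zero_of_pointwise (A := fun j => M x ^ j * P) fun z => hP1 z
  have hB := tendsto_norm_zero_of_pointwise (A := fun j => M' x ^ j * Q) fun z => hP2 z
  -- A power of M x contracts the stable part by 1/4 and expands the unstable part by 4, which
  -- leaves room for a perturbation.
  obtain ⟨j, hjA, hjB, hj0⟩ :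
      ∃ j : ℕ, ‖M x ^ j * P‖ < 1 / 4 ∧ ‖M' x ^ j * Q‖ < 1 / 4 ∧ 0 < j :=
    ((hA.eventually (gt_mem_nhds (by norm_num))).and
      ((hB.eventually (gt_mem_nhds (by norm_num))).and (eventually_gt_atTop 0))).exists
  -- In the cone ε‖P u‖ ≤ ‖Q u‖ one has ε(‖P u‖ + ‖Q u‖) ≤ 2‖Q u‖, so this δ makes both components
  -- of the perturbation `d` at most ‖Q u‖ / 2.
  set δ : ℝ := ε / (4 * (‖P‖ + ‖Q‖ + 1)) with hδ
  have hδ0 : 0 < δ := by positivity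
  have hPQ : δ * (‖P‖ + ‖Q‖) ≤ ε / 4 := by
    rw [hδ, div_mul_eq_mul_div, div_le_div_iff₀ (by positivity) (by norm_num)]
    nlinarith
  have hev : ∀ᶠ y in 𝓝 x, ‖M y ^ j - M x ^ j‖ < δ := by
    have : Tendsto (fun y => M y ^ j) (𝓝 x) (𝓝 (M x ^ j)) := (hM.pow j).tendsto x
    have h := this.eventually (Metric.ball_mem_nhds _ hδ0)
    simpa only [dist_eq_norm, Metric.mem_ball] using h
  have hev2 : ∀ᶠ w in 𝓝 z, ε * ‖P w‖ < ‖Q w‖ :=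
    (isOpen_lt (continuous_const.mul P.continuous.norm) Q.continuous.norm).mem_nhds hεz
  filter_upwards [hev.prod_nhds hev2]
  rintro ⟨y, w⟩ ⟨hy, hw⟩ hst
  simp only at hy hw
  have hst' : Tendsto (fun i : ℕ => (M y ^ i) w) atTop (𝓝 0) := hst
  -- one step preserves the cone and expands
  have step : ∀ u : F, ε * ‖P u‖ ≤ ‖Q u‖ →
      ε * ‖P ((M y ^ j) u)‖ ≤ ‖Q ((M y ^ j) u)‖ ∧ ‖Q u‖ ≤ ‖Q ((M y ^ j) u)‖ := by
    intro u hu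
    set d := (M y ^ j - M x ^ j) u with hdd
    have e0 : (M y ^ j) u = (M x ^ j) u + d := by simp [hdd]
    have hu2 : ‖u‖ ≤ ‖P u‖ + ‖Q u‖ := by
      have : u = P u + Q u := by simp [hQ]
      calc ‖u‖ = ‖P u + Q u‖ := by rw [← this]
        _ ≤ _ := norm_add_le _ _
    have hd1 : ‖d‖ ≤ δ * (‖P u‖ + ‖Q u‖) :=
      ((M y ^ j - M x ^ j).le_opNorm u).trans (mul_le_mul hy.le hu2 (norm_nonneg _) hδ0.le)
    have hεd : ε * (‖P u‖ + ‖Q u‖) ≤ 2 * ‖Q u‖ := by nlinarith [norm_nonneg (Q u)]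
    have hPd : ‖P d‖ ≤ ‖Q u‖ / 2 := by
      have : ‖P d‖ ≤ ‖P‖ * (δ * (‖P u‖ + ‖Q u‖)) :=
        (P.le_opNorm d).trans (mul_le_mul_of_nonneg_left hd1 (norm_nonneg _))
      nlinarith [norm_nonneg (P u), norm_nonneg (Q u), norm_nonneg Q,
        mul_nonneg hδ0.le (mul_nonneg (norm_nonneg Q) (add_nonneg (norm_nonneg (P u)) (norm_nonneg (Q u)))),
        mul_le_mul_of_nonneg_right hPQ (add_nonneg (norm_nonneg (P u)) (norm_nonneg (Q u)))]
    have hQd : ‖Q d‖ ≤ ‖Q u‖ / 2 := by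
      have : ‖Q d‖ ≤ ‖Q‖ * (δ * (‖P u‖ + ‖Q u‖)) :=
        (Q.le_opNorm d).trans (mul_le_mul_of_nonneg_left hd1 (norm_nonneg _))
      nlinarith [norm_nonneg (P u), norm_nonneg (Q u), norm_nonneg P,
        mul_nonneg hδ0.le (mul_nonneg (norm_nonneg P) (add_nonneg (norm_nonneg (P u)) (norm_nonneg (Q u)))),
        mul_le_mul_of_nonneg_right hPQ (add_nonneg (norm_nonneg (P u)) (norm_nonneg (Q u)))]
    have hPP : P * P = P := by
      ext u
      have h3 : P u - P (P u) ∈ stable (M x) ⊓ stable (M' x) :=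
        ⟨sub_mem (hP1 _) (hP1 _), hP2 _⟩
      rw [(disjoint_iff.1 (hd x)), Submodule.mem_bot, sub_eq_zero] at h3
      exact h3.symm
    have hQQ : Q * Q = Q := by rw [hQ]; simp [mul_sub, sub_mul, hPP]
    have hPs : ‖P ((M x ^ j) u)‖ ≤ 1 / 4 * ‖P u‖ := by
      have : P ((M x ^ j) u) = (M x ^ j * P) (P u) := by
        change (P * M x ^ j) u = (M x ^ j * P * P) u
        rw [mul_assoc, hPP, (hPM.pow_right j).eq]
      rw [this]
      exact ((M x ^ j * P).le_opNorm _).trans (by gcongr)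
    have hQs : ‖Q u‖ ≤ 1 / 4 * ‖Q ((M x ^ j) u)‖ := by
      have : Q u = (M' x ^ j * Q) (Q ((M x ^ j) u)) := by
        change Q u = (M' x ^ j * Q * (Q * M x ^ j)) u
        rw [mul_assoc, ← mul_assoc Q Q, hQQ, (hQM.pow_right j).eq, ← mul_assoc, ← hMM.symm.mul_pow,
          h2, one_pow, one_mul]
      calc ‖Q u‖ = ‖(M' x ^ j * Q) (Q ((M x ^ j) u))‖ := by rw [← this]
        _ ≤ _ := ((M' x ^ j * Q).le_opNorm _).trans (by gcongr)
    have hP3 : ‖P ((M y ^ j) u)‖ ≤ 1 / 4 * ‖P u‖ + ‖Q u‖ / 2 := by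
      rw [e0, map_add]
      exact (norm_add_le _ _).trans (add_le_add hPs hPd)
    have hQ3 : ‖Q ((M x ^ j) u)‖ - ‖Q u‖ / 2 ≤ ‖Q ((M y ^ j) u)‖ := by
      rw [e0, map_add]
      have := norm_sub_le (Q ((M x ^ j) u) + Q d) (Q d)
      rw [add_sub_cancel_right] at this
      linarith
    constructor
    · nlinarith [norm_nonneg (Q u), norm_nonneg (P u)]
    · nlinarith [norm_nonneg (Q u), norm_nonneg (P u)]
  have iter : ∀ i : ℕ, ε * ‖P ((M y ^ (j * i)) w)‖ ≤ ‖Q ((M y ^ (j * i)) w)‖ ∧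
      ‖Q w‖ ≤ ‖Q ((M y ^ (j * i)) w)‖ := by
    intro i
    induction i with
    | zero => simpa using hw.le
    | succ i ih =>
      have h3 := step _ ih.1
      have h4 : (M y ^ j) ((M y ^ (j * i)) w) = (M y ^ (j * (i + 1))) w := by
        rw [mul_add, mul_one, add_comm, pow_add]; rfl
      rw [h4] at h3
      exact ⟨h3.1, ih.2.trans h3.2⟩
  have hw0 : 0 < ‖Q w‖ := lt_of_le_of_lt (by positivity) hw
  -- If w were stable for M y, its Q-component would tend to 0 along multiples of j, although in the
  -- cone it never falls below ‖Q w‖ > 0.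
  have hlim : Tendsto (fun i : ℕ => ‖Q ((M y ^ (j * i)) w)‖) atTop (𝓝 0) := by
    have h5 := ((Q.continuous.tendsto 0).comp hst').norm.comp
      (tendsto_id.const_mul_atTop' hj0)
    rw [map_zero, norm_zero] at h5
    exact h5
  exact absurd (ge_of_tendsto' hlim fun i => (iter i).2) (not_le.2 hw0)

end Dichotomy

/-! ### Transfer matrices, conserved flux, and decay of L² solutions. -/

section Transfer

variable {N : ℕ}

/-- The space of Cauchy data `(ψ, ψ')`. -/
abbrev Phase (N : ℕ) : Type := Chan N × Chan N

/-- `act A` as a continuous linear map. -/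
def actCLM (A : Matrix (Fin N) (Fin N) ℂ) : Chan N →L[ℂ] Chan N := Matrix.toEuclideanCLM (𝕜 := ℂ) A

theorem actCLM_apply (A : Matrix (Fin N) (Fin N) ℂ) (a : Chan N) : actCLM A a = act A a :=
  Matrix.toEuclideanCLM_toLp A a.ofLp

theorem continuous_actCLM :
    Continuous (actCLM : Matrix (Fin N) (Fin N) ℂ → Chan N →L[ℂ] Chan N) :=
  (Matrix.toEuclideanCLM (n := Fin N) (𝕜 := ℂ)).toAlgEquiv.toLinearMap.continuous_of_finiteDimensional

theorem inner_act_self_im {A : Matrix (Fin N) (Fin N) ℂ} (hA : A.IsHermitian) (a : Chan N) :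
    (inner ℂ a (act A a)).im = 0 := by
  have h := Matrix.isSymmetric_toEuclideanLin_iff.2 hA a a
  have h2 : inner ℂ (act A a) a = inner ℂ a (act A a) := h
  have h3 := inner_conj_symm (𝕜 := ℂ) a (act A a)
  rw [h2] at h3
  exact Complex.conj_eq_iff_im.1 h3

/-- The generator of the first-order system for `-ψ'' + A ψ = k² ψ`. -/
def generator (k : ℝ) (A : Matrix (Fin N) (Fin N) ℂ) : Phase N →L[ℂ] Phase N :=
  (ContinuousLinearMap.snd ℂ (Chan N) (Chan N)).prod
    ((actCLM A - (k : ℂ) ^ 2 • ContinuousLinearMap.id ℂ (Chan N)).comp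
      (ContinuousLinearMap.fst ℂ (Chan N) (Chan N)))

theorem generator_apply (k : ℝ) (A : Matrix (Fin N) (Fin N) ℂ) (z : Phase N) :
    generator k A z = (z.2, act A z.1 - (k : ℂ) ^ 2 • z.1) := by
  simp [generator, actCLM_apply]

theorem continuous_generator (k : ℝ) :
    Continuous (generator k : Matrix (Fin N) (Fin N) ℂ → Phase N →L[ℂ] Phase N) := by
  refine continuous_clm_apply.2 fun z => ?_
  simp only [generator_apply, ← actCLM_apply]
  exact continuous_const.prodMk
    (((ContinuousLinearMap.apply ℂ (Chan N) z.1).continuous.comp continuous_actCLM).sub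
      continuous_const)

/-- A continuous bounded Hermitian potential of period `L`. -/
structure IsPeriodicPotential (k L : ℝ) (U : ℝ → Matrix (Fin N) (Fin N) ℂ) : Prop where
  cont : Continuous U
  herm : ∀ x, (U x).IsHermitian
  bdd : ∃ K, ∀ x, ‖generator k (U x)‖ ≤ K
  per : ∀ x, U (x + L) = U x

theorem IsPeriodicPotential.translate {k L : ℝ} {U : ℝ → Matrix (Fin N) (Fin N) ℂ}
    (h : IsPeriodicPotential k L U) (c : ℝ) : IsPeriodicPotential k L fun y => U (c + y) where
  cont := h.cont.comp (continuous_const.add continuous_id)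
  herm _ := h.herm _
  bdd := h.bdd.imp fun _ hK x => hK (c + x)
  per x := by rw [← add_assoc, h.per]

/-- The transfer matrix from `0` to `y` of Cauchy data at energy `k²`. -/
def transfer (k : ℝ) (U : ℝ → Matrix (Fin N) (Fin N) ℂ) (y : ℝ) : Phase N →L[ℂ] Phase N :=
  propagator (fun y => generator k (U y)) y

variable {k L : ℝ} {U : ℝ → Matrix (Fin N) (Fin N) ℂ}

theorem transfer_zero : transfer k U 0 = 1 := propagator_zero _

namespace IsPeriodicPotential

variable (h : IsPeriodicPotential k L U)

include h

theorem continuous_gen : Continuous fun y => generator k (U y) :=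
  (continuous_generator k).comp h.cont

theorem hasDerivAt_transfer (z : Phase N) (y : ℝ) :
    HasDerivAt (fun y => transfer k U y z) (generator k (U y) (transfer k U y z)) y := by
  obtain ⟨K, hK⟩ := h.bdd
  exact hasDerivAt_propagator_apply h.continuous_gen hK z y

theorem hasDerivAt_fst (z : Phase N) (y : ℝ) :
    HasDerivAt (fun y => (transfer k U y z).1) (transfer k U y z).2 y := by
  have h1 := h.hasDerivAt_transfer z y
  rw [generator_apply] at h1
  exact (ContinuousLinearMap.fst ℝ (Chan N) (Chan N)).hasFDerivAt.comp_hasDerivAt y h1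

theorem hasDerivAt_snd (z : Phase N) (y : ℝ) :
    HasDerivAt (fun y => (transfer k U y z).2)
      (act (U y) (transfer k U y z).1 - (k : ℂ) ^ 2 • (transfer k U y z).1) y := by
  have h1 := h.hasDerivAt_transfer z y
  rw [generator_apply] at h1
  exact (ContinuousLinearMap.snd ℝ (Chan N) (Chan N)).hasFDerivAt.comp_hasDerivAt y h1

theorem eq_transfer {ψ ψ' : ℝ → Chan N} (h1 : ∀ y, HasDerivAt ψ (ψ' y) y)
    (h2 : ∀ y, HasDerivAt ψ' (act (U y) (ψ y) - (k : ℂ) ^ 2 • ψ y) y) (y : ℝ) :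
    (ψ y, ψ' y) = transfer k U y (ψ 0, ψ' 0) := by
  obtain ⟨K, hK⟩ := h.bdd
  refine eq_propagator_apply h.continuous_gen hK (z := fun y => (ψ y, ψ' y)) (fun t => ?_) y
  rw [generator_apply]
  exact (h1 t).prodMk (h2 t)

theorem transfer_add_nat_mul (y : ℝ) (j : ℕ) :
    transfer k U (y + j * L) = transfer k U y * transfer k U L ^ j := by
  obtain ⟨K, hK⟩ := h.bdd
  exact propagator_add_nat_mul_period h.continuous_gen hK (fun t => by rw [h.per]) y j

theorem neg : IsPeriodicPotential k (-L) U where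
  cont := h.cont
  herm := h.herm
  bdd := h.bdd
  per x := by rw [← h.per (x + -L), neg_add_cancel_right]

theorem transfer_mul_neg : transfer k U L * transfer k U (-L) = 1 := by
  obtain ⟨K, hK⟩ := h.bdd
  exact propagator_period_mul_neg h.continuous_gen hK fun t => by rw [h.per]

theorem transfer_neg_mul : transfer k U (-L) * transfer k U L = 1 := by
  obtain ⟨K, hK⟩ := h.bdd
  exact propagator_neg_period_mul h.continuous_gen hK fun t => by rw [h.per]

end IsPeriodicPotential

/-- The probability flux carried by Cauchy data. -/
def flux (z : Phase N) : ℝ := (inner ℂ z.1 z.2).im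

theorem continuous_flux : Continuous (flux : Phase N → ℝ) :=
  Complex.continuous_im.comp (continuous_fst.inner continuous_snd)

/-- The derivative of ⟨ψ, ψ'⟩ is ⟨ψ, (U - k²)ψ⟩ + ‖ψ'‖², which is real because U is Hermitian. -/
theorem IsPeriodicPotential.flux_transfer (h : IsPeriodicPotential k L U) (z : Phase N) (y : ℝ) :
    flux (transfer k U y z) = flux z := by
  have hd : ∀ y, HasDerivAt (fun y => flux (transfer k U y z)) 0 y := by
    intro y
    have h1 := (h.hasDerivAt_fst z y).inner ℂ (h.hasDerivAt_snd z y)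
    have h2 := Complex.imCLM.hasFDerivAt.comp_hasDerivAt y h1
    have e1 := inner_act_self_im (h.herm y) (transfer k U y z).1
    have e2 : ((k : ℂ) ^ 2).im = 0 := by rw [← Complex.ofReal_pow, Complex.ofReal_im]
    have e3 : Complex.imCLM (inner ℂ (transfer k U y z).1 (act (U y) (transfer k U y z).1 -
        (k : ℂ) ^ 2 • (transfer k U y z).1) +
        inner ℂ (transfer k U y z).2 (transfer k U y z).2) = 0 := by
      rw [Complex.imCLM_apply, Complex.add_im, inner_sub_right, inner_smul_right, Complex.sub_im,
        e1, inner_self_eq_norm_sq_to_K, inner_self_eq_norm_sq_to_K, Complex.mul_im, e2]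
      simp [← Complex.ofReal_pow]
    rw [e3] at h2
    exact h2
  have hc := is_const_of_deriv_eq_zero (fun y => (hd y).differentiableAt) (fun y => (hd y).deriv) y 0
  simpa [transfer_zero] using hc

/-- The flux is constant along the iterates, which tend to 0. -/
theorem IsPeriodicPotential.flux_eq_zero (h : IsPeriodicPotential k L U) {z : Phase N}
    (hz : z ∈ stable (transfer k U L)) : flux z = 0 := by
  have h1 : ∀ j : ℕ, flux ((transfer k U L ^ j) z) = flux z := by
    intro j
    have := h.transfer_add_nat_mul 0 j
    rw [transfer_zero, one_mul] at this
    rw [← this, h.flux_transfer]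
  have h2 := (continuous_flux.tendsto 0).comp (mem_stable.1 hz)
  have h3 : Tendsto (fun _ : ℕ => flux z) atTop (𝓝 (flux (0 : Phase N))) :=
    h2.congr h1
  have h4 : flux (0 : Phase N) = 0 := by simp [flux]
  rw [h4] at h3
  exact tendsto_nhds_unique tendsto_const_nhds h3

/-- The Cauchy data of `e^{ikx} a + e^{-ikx} b` at `0`. -/
def data (k : ℝ) (a b : Chan N) : Phase N := (a + b, (Complex.I * k) • (a - b))

/-- The amplitude of the incoming wave. -/
def incoming (k : ℝ) : Phase N →ₗ[ℂ] Chan N :=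
  (1 / 2 : ℂ) • (LinearMap.fst ℂ (Chan N) (Chan N) +
    (Complex.I * k)⁻¹ • LinearMap.snd ℂ (Chan N) (Chan N))

/-- The amplitude of the outgoing wave. -/
def outgoing (k : ℝ) : Phase N →ₗ[ℂ] Chan N :=
  (1 / 2 : ℂ) • (LinearMap.fst ℂ (Chan N) (Chan N) -
    (Complex.I * k)⁻¹ • LinearMap.snd ℂ (Chan N) (Chan N))

theorem incoming_apply (k : ℝ) (z : Phase N) :
    incoming k z = (1 / 2 : ℂ) • (z.1 + (Complex.I * k)⁻¹ • z.2) := rfl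

theorem outgoing_apply (k : ℝ) (z : Phase N) :
    outgoing k z = (1 / 2 : ℂ) • (z.1 - (Complex.I * k)⁻¹ • z.2) := rfl

theorem incoming_data (hk : k ≠ 0) (a b : Chan N) : incoming k (data k a b) = a := by
  have : Complex.I * k ≠ 0 := mul_ne_zero Complex.I_ne_zero (Complex.ofReal_ne_zero.2 hk)
  rw [incoming_apply, data, inv_smul_smul₀ this]
  module

theorem outgoing_data (hk : k ≠ 0) (a b : Chan N) : outgoing k (data k a b) = b := by
  have : Complex.I * k ≠ 0 := mul_ne_zero Complex.I_ne_zero (Complex.ofReal_ne_zero.2 hk)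
  rw [outgoing_apply, data, inv_smul_smul₀ this]
  module

theorem data_incoming_outgoing (hk : k ≠ 0) (z : Phase N) :
    data k (incoming k z) (outgoing k z) = z := by
  have : Complex.I * k ≠ 0 := mul_ne_zero Complex.I_ne_zero (Complex.ofReal_ne_zero.2 hk)
  rw [incoming_apply, outgoing_apply, data]
  ext1
  · simp only; module
  · have e : (1 / 2 : ℂ) • (z.1 + (Complex.I * k)⁻¹ • z.2) -
        (1 / 2 : ℂ) • (z.1 - (Complex.I * k)⁻¹ • z.2) = (Complex.I * k)⁻¹ • z.2 := by module
    simp only [e]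
    rw [smul_inv_smul₀ this]

theorem flux_data (k : ℝ) (a b : Chan N) : flux (data k a b) = k * (‖a‖ ^ 2 - ‖b‖ ^ 2) := by
  have e1 := inner_self_eq_norm_sq_to_K (𝕜 := ℂ) a
  have e2 := inner_self_eq_norm_sq_to_K (𝕜 := ℂ) b
  have e3 := inner_conj_symm (𝕜 := ℂ) a b
  rw [flux, data]
  simp only
  rw [inner_smul_right, inner_add_left, inner_sub_right, inner_sub_right, e1, e2, ← e3]
  simp only [Complex.mul_im, Complex.mul_re, Complex.I_re, Complex.I_im, Complex.ofReal_re,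
    Complex.ofReal_im, Complex.add_re, Complex.sub_re, Complex.conj_re, Complex.coe_algebraMap,
    ← Complex.ofReal_pow]
  ring

theorem norm_incoming_eq (hk : 0 < k) {z : Phase N} (hz : flux z = 0) :
    ‖outgoing k z‖ = ‖incoming k z‖ := by
  rw [← data_incoming_outgoing hk.ne' z, flux_data, mul_eq_zero, sub_eq_zero] at hz
  exact ((pow_left_inj₀ (norm_nonneg _) (norm_nonneg _) two_ne_zero).1
    (hz.resolve_left hk.ne')).symm

/-- Zero flux forces ‖a‖ = ‖b‖, so the data vanish with the incoming amplitude. This bounds the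
dimension of a flux-free subspace by N. -/
theorem incoming_injOn (hk : 0 < k) {S : Submodule ℂ (Phase N)} (hS : ∀ z ∈ S, flux z = 0) :
    Function.Injective ((incoming k).domRestrict S) := by
  rw [← LinearMap.ker_eq_bot, LinearMap.ker_eq_bot']
  rintro ⟨z, hz⟩ h0
  have h1 : incoming k z = 0 := h0
  have h2 : outgoing k z = 0 := by
    rw [← norm_eq_zero, norm_incoming_eq hk (hS z hz), h1, norm_zero]
  have h3 := data_incoming_outgoing hk.ne' z
  rw [h1, h2] at h3
  ext1
  change z = 0
  rw [← h3]
  simp [data]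

theorem finrank_le_of_flux (hk : 0 < k) {S : Submodule ℂ (Phase N)} (hS : ∀ z ∈ S, flux z = 0) :
    Module.finrank ℂ S ≤ N := by
  have := LinearMap.finrank_le_finrank_of_injective (incoming_injOn hk hS)
  simpa using this

/-- If ψ vanished on [0, L], its one-sided derivative at 0 would vanish too, hence all Cauchy data.
-/
theorem IsPeriodicPotential.exists_fst_ne_zero (h : IsPeriodicPotential k L U) (hL : 0 < L)
    {z : Phase N} (hz : z ≠ 0) : ∃ c ∈ Set.Icc 0 L, (transfer k U c z).1 ≠ 0 := by
  by_contra! hc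
  apply hz
  have h0 := hc 0 ⟨le_rfl, hL.le⟩
  rw [transfer_zero] at h0
  have h1 : HasDerivWithinAt (fun y => (transfer k U y z).1) 0 (Set.Icc 0 L) 0 :=
    (hasDerivWithinAt_const 0 (Set.Icc 0 L) (0 : Chan N)).congr hc (hc 0 ⟨le_rfl, hL.le⟩)
  have h2 := UniqueDiffWithinAt.eq_deriv _ (uniqueDiffOn_Icc hL 0 ⟨le_rfl, hL.le⟩) h1
    (h.hasDerivAt_fst z 0).hasDerivWithinAt
  rw [transfer_zero] at h2
  exact Prod.ext h0 h2.symm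

theorem IsPeriodicPotential.continuous_transfer (h : IsPeriodicPotential k L U) :
    Continuous (transfer k U) := by
  obtain ⟨K, hK⟩ := h.bdd
  exact continuous_iff_continuousAt.2 fun t =>
    (hasDerivAt_propagator h.continuous_gen hK t).continuousAt

/-- Smallness of a solution in `L²` over a period controls its Cauchy data. -/
theorem IsPeriodicPotential.tendsto_of_integral (h : IsPeriodicPotential k L U) (hL : 0 < L)
    {z : ℕ → Phase N}
    (hz : Tendsto (fun j => ∫ y in (0 : ℝ)..L, ‖(transfer k U y (z j)).1‖ ^ 2) atTop (𝓝 0)) :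
    Tendsto z atTop (𝓝 0) := by
  set q : Phase N → ℝ := fun z => ∫ y in (0 : ℝ)..L, ‖(transfer k U y z).1‖ ^ 2 with hq
  have hc : Continuous fun p : Phase N × ℝ => ‖(transfer k U p.2 p.1).1‖ ^ 2 :=
    ((continuous_fst.comp ((h.continuous_transfer.comp continuous_snd).clm_apply
      continuous_fst)).norm.pow 2)
  have hqc : Continuous q :=
    intervalIntegral.continuous_parametric_intervalIntegral_of_continuous' (f := fun z y =>
      ‖(transfer k U y z).1‖ ^ 2) hc 0 L
  have hpos : ∀ z ∈ Metric.sphere (0 : Phase N) 1, 0 < q z := by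
    intro z hz
    obtain ⟨c, hc1, hc2⟩ := h.exists_fst_ne_zero hL (z := z) (by
      rintro rfl
      simp at hz)
    exact intervalIntegral.integral_pos hL
      (hc.comp (continuous_const.prodMk continuous_id)).continuousOn
      (fun x _ => by positivity) ⟨c, hc1, by positivity⟩
  -- Compactness of the sphere gives a positive lower bound; homogeneity of degree 2 extends it to
  -- all data.
  obtain ⟨m, hm, hmq⟩ := (isCompact_sphere (0 : Phase N) 1).exists_forall_le' hqc.continuousOn hpos
  have hlow : ∀ z, m * ‖z‖ ^ 2 ≤ q z := by
    intro z
    rcases eq_or_ne z 0 with rfl | hz0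
    · simp [hq]
    · have hn : ‖z‖ ≠ 0 := norm_ne_zero_iff.2 hz0
      have h1 := hmq ((‖z‖⁻¹ : ℂ) • z) (by
        simp [norm_smul, hn])
      have h2 : q ((‖z‖⁻¹ : ℂ) • z) = (‖z‖ ^ 2)⁻¹ * q z := by
        simp only [hq, map_smul, Prod.smul_fst, norm_smul, mul_pow]
        rw [intervalIntegral.integral_const_mul]
        simp
      rw [h2] at h1
      rwa [← div_eq_inv_mul, le_div_iff₀ (by positivity)] at h1
  rw [tendsto_zero_iff_norm_tendsto_zero]
  have h1 : Tendsto (fun j => ‖z j‖ ^ 2) atTop (𝓝 0) := by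
    have := hz.const_mul m⁻¹
    rw [mul_zero] at this
    refine squeeze_zero (fun j => by positivity) (fun j => ?_) this
    rw [← div_eq_inv_mul, le_div_iff₀ hm, mul_comm]
    exact hlow (z j)
  have h2 := h1.sqrt
  simpa using h2

/-- Each window is a difference of two consecutive terms of the convergent sequence of integrals
from a to a + jL. -/
theorem tendsto_integral_window_atTop {f : ℝ → ℝ} {a : ℝ} (hf : IntegrableOn f (Set.Ioi a))
    (hL : 0 < L) :
    Tendsto (fun j : ℕ => ∫ y in (0 : ℝ)..L, f (a + (y + j * L))) atTop (𝓝 0) := by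
  have hb : Tendsto (fun j : ℕ => a + j * L) atTop atTop :=
    tendsto_atTop_add_const_left _ _ (tendsto_natCast_atTop_atTop.atTop_mul_const hL)
  have h1 := intervalIntegral_tendsto_integral_Ioi a hf hb
  have h2 := ((tendsto_add_atTop_iff_nat 1).2 h1).sub h1
  rw [sub_self] at h2
  refine h2.congr fun j => ?_
  have hj : a ≤ a + j * L := le_add_of_nonneg_right (by positivity)
  have hi : ∀ b, a ≤ b → IntervalIntegrable f volume a b := fun b hb =>
    (intervalIntegrable_iff_integrableOn_Ioc_of_le hb).2 (hf.mono_set Set.Ioc_subset_Ioi_self)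
  rw [intervalIntegral.integral_interval_sub_left (hi _ (by push_cast; nlinarith)) (hi _ hj)]
  have e := intervalIntegral.integral_comp_add_left (a := 0) (b := L) f (a + j * L)
  have e2 : ∀ y, f (a + (y + j * L)) = f (a + j * L + y) := fun y => by ring_nf
  simp only [e2]
  rw [e]
  push_cast
  ring_nf

theorem tendsto_integral_window_atBot {f : ℝ → ℝ} {a : ℝ} (hf : IntegrableOn f (Set.Iic a))
    (hL : 0 < L) :
    Tendsto (fun j : ℕ => ∫ y in (0 : ℝ)..L, f (a + (y + j * -L))) atTop (𝓝 0) := by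
  have hb : Tendsto (fun j : ℕ => a + j * -L) atTop atBot :=
    tendsto_atBot_add_const_left _ _
      (tendsto_natCast_atTop_atTop.atTop_mul_const_of_neg (neg_lt_zero.2 hL))
  have h1 := intervalIntegral_tendsto_integral_Iic a hf hb
  have h2 := ((tendsto_add_atTop_iff_nat 1).2 h1).sub h1
  rw [sub_self] at h2
  -- The window with j = 0 is [a, a + L], outside the half-line of integrability, so the index
  -- starts at 1.
  rw [← tendsto_add_atTop_iff_nat 1]
  refine h2.congr fun j => ?_
  have hj : a + j * -L ≤ a := by
    have : 0 ≤ (j : ℝ) * L := by positivity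
    linarith
  have hi : ∀ b, b ≤ a → IntervalIntegrable f volume b a := fun b hb =>
    (intervalIntegrable_iff_integrableOn_Ioc_of_le hb).2 (hf.mono_set Set.Ioc_subset_Iic_self)
  have hj1 : a + ((j + 1 : ℕ) : ℝ) * -L ≤ a := by push_cast; nlinarith
  have e0 := intervalIntegral.integral_add_adjacent_intervals
    ((hi _ hj1).trans (hi _ hj).symm) (hi _ hj)
  rw [← e0, add_sub_cancel_right]
  have e := intervalIntegral.integral_comp_add_left (a := 0) (b := L) f (a + (j + 1) * -L)
  have e2 : ∀ y, f (a + (y + ((j + 1 : ℕ) : ℝ) * -L)) = f (a + (j + 1) * -L + y) := fun y => by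
    push_cast; ring_nf
  simp only [e2]
  rw [e]
  push_cast
  ring_nf

/-- The j-th window of the solution is the solution on [0, L] with data M^j z, M being the transfer
matrix over a period. Small window integrals thus force M^j z → 0. -/
theorem IsPeriodicPotential.mem_stable_of_integrable (h : IsPeriodicPotential k L U) (hL : 0 < L)
    {z : Phase N} {f : ℝ → Chan N} {a : ℝ} (hf : IntegrableOn (fun x => ‖f x‖ ^ 2) (Set.Ioi a))
    (hfz : ∀ᶠ y in atTop, f (a + y) = (transfer k U y z).1) : z ∈ stable (transfer k U L) := by
  refine h.tendsto_of_integral hL ((tendsto_integral_window_atTop hf hL).congr' ?_)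
  obtain ⟨b, hb⟩ := eventually_atTop.1 hfz
  filter_upwards [(tendsto_natCast_atTop_atTop (R := ℝ)).atTop_mul_const hL |>.eventually_ge_atTop b]
    with j hj
  refine intervalIntegral.integral_congr fun y hy => ?_
  rw [Set.uIcc_of_le hL.le] at hy
  rw [hb _ (by linarith [hy.1]), h.transfer_add_nat_mul]
  rfl

theorem IsPeriodicPotential.mem_stable_neg_of_integrable (h : IsPeriodicPotential k L U)
    (hL : 0 < L) {z : Phase N} {f : ℝ → Chan N} {a : ℝ}
    (hf : IntegrableOn (fun x => ‖f x‖ ^ 2) (Set.Iic a))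
    (hfz : ∀ᶠ y in atBot, f (a + y) = (transfer k U y z).1) : z ∈ stable (transfer k U (-L)) := by
  refine h.tendsto_of_integral hL ((tendsto_integral_window_atBot hf hL).congr' ?_)
  obtain ⟨b, hb⟩ := eventually_atBot.1 hfz
  filter_upwards [(tendsto_natCast_atTop_atTop (R := ℝ)).atTop_mul_const_of_neg (neg_lt_zero.2 hL)
    |>.eventually_le_atBot (b - L)] with j hj
  refine intervalIntegral.integral_congr fun y hy => ?_
  rw [Set.uIcc_of_le hL.le] at hy
  rw [hb _ (by linarith [hy.2]), h.neg.transfer_add_nat_mul]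
  rfl

end Transfer

/-! ### From the spectral gap to hyperbolicity. -/

section Splitting

variable {N : ℕ} {k L : ℝ} {U : ℝ → Matrix (Fin N) (Fin N) ℂ}

theorem locallyIntegrable_L2 (u : L2 N) : LocallyIntegrable u :=
  (Lp.memLp u).locallyIntegrable one_le_two

/-- Every element of the domain of the Hamiltonian with a continuous image under `H - k²` has a
representative that is a classical solution of the inhomogeneous equation. -/
theorem exists_classical_of_hamiltonianGraph (hU : Continuous U) {f : ℝ → Chan N}
    (hf : Continuous f) {fL u : L2 N} (hfL : fL =ᵐ[volume] f)
    (hu : HamiltonianGraph U u (fL + ((k : ℂ) ^ 2) • u)) :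
    ∃ w w' : ℝ → Chan N, u =ᵐ[volume] w ∧ (∀ x, HasDerivAt w (w' x) x) ∧
      ∀ x, HasDerivAt w' (act (U x) (w x) - (k : ℂ) ^ 2 • w x - f x) x := by
  obtain ⟨g, hg, hae⟩ := hu
  obtain ⟨C, D, hCD⟩ := ae_eq_of_weak_second_deriv (locallyIntegrable_L2 u)
    (locallyIntegrable_L2 g) hg
  have hgi := intervalIntegrable_of_locallyIntegrable (locallyIntegrable_L2 g)
  set w' : ℝ → Chan N := fun y => C + ∫ t in (0 : ℝ)..y, g t with hw'
  set w : ℝ → Chan N := fun x => D + ∫ y in (0 : ℝ)..x, w' y with hw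
  have hw'c : Continuous w' :=
    continuous_const.add (intervalIntegral.continuous_primitive hgi 0)
  have hwd : ∀ x, HasDerivAt w (w' x) x := fun x =>
    (hw'c.integral_hasStrictDerivAt 0 x).hasDerivAt.const_add D
  have hwc : Continuous w := continuous_iff_continuousAt.2 fun x => (hwd x).continuousAt
  set G : ℝ → Chan N := fun x => act (U x) (w x) - (k : ℂ) ^ 2 • w x - f x with hG
  have hGc : Continuous G := by
    have : Continuous fun x => act (U x) (w x) := by
      simp only [← actCLM_apply]
      exact (continuous_actCLM.comp hU).clm_apply hwc
    have h2 : Continuous fun x => (k : ℂ) ^ 2 • w x := by fun_prop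
    exact Continuous.sub (Continuous.sub this h2) hf
  -- The equation identifies g almost everywhere with a continuous function, so its primitive `w'`
  -- is C¹.
  have hgG : g =ᵐ[volume] G := by
    filter_upwards [hae, hCD, hfL, Lp.coeFn_add fL (((k : ℂ) ^ 2) • u),
      Lp.coeFn_smul ((k : ℂ) ^ 2) u] with x h1 h2 h3 h4 h5
    have e : (fL + ((k : ℂ) ^ 2) • u : L2 N) x = f x + (k : ℂ) ^ 2 • w x :=
      h4.trans (congrArg₂ (· + ·) h3 (h5.trans (congrArg (((k : ℂ) ^ 2) • ·) h2)))
    have e2 : act (U x) (u x) = act (U x) (w x) := congrArg (act (U x)) h2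
    have e3 : f x + (k : ℂ) ^ 2 • w x = -g x + act (U x) (w x) := by rw [← e, h1, e2]
    change g x = act (U x) (w x) - (k : ℂ) ^ 2 • w x - f x
    rw [eq_sub_iff_add_eq, eq_sub_iff_add_eq, add_assoc, e3]
    abel
  refine ⟨w, w', hCD, hwd, fun x => ?_⟩
  have e : w' = fun y => C + ∫ t in (0 : ℝ)..y, G t := by
    funext y
    rw [hw']
    simp only
    rw [intervalIntegral.integral_congr_ae (hgG.mono fun x hx _ => hx)]
  rw [e]
  exact (hGc.integral_hasStrictDerivAt 0 x).hasDerivAt.const_add C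

theorem integrable_sq_of_ae_eq {u : L2 N} {w : ℝ → Chan N} (h : u =ᵐ[volume] w) :
    Integrable fun x => ‖w x‖ ^ 2 := by
  have h1 : MemLp w 2 := (memLp_congr_ae h).1 (Lp.memLp u)
  exact (memLp_two_iff_integrable_sq_norm h1.1).1 h1

theorem exists_cutoff : ∃ χ χ' χ'' : ℝ → ℝ, (∀ x, HasDerivAt χ (χ' x) x) ∧
    (∀ x, HasDerivAt χ' (χ'' x) x) ∧ Continuous χ'' ∧ (∀ x ≤ 0, χ x = 0) ∧ (∀ x, 1 ≤ x → χ x = 1) ∧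
    ∀ x ∉ Set.Icc (0 : ℝ) 1, χ' x = 0 ∧ χ'' x = 0 := by
  have hs : ContDiff ℝ ∞ Real.smoothTransition := Real.smoothTransition.contDiff
  have hs1 := (contDiff_infty_iff_deriv.1 hs).2
  have hs2 := (contDiff_infty_iff_deriv.1 hs1).2
  refine ⟨Real.smoothTransition, deriv Real.smoothTransition, deriv (deriv Real.smoothTransition),
    fun x => (hs.differentiable (by simp) x).hasDerivAt,
    fun x => (hs1.differentiable (by simp) x).hasDerivAt, hs2.continuous,
    fun x hx => Real.smoothTransition.zero_of_nonpos hx,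
    fun x hx => Real.smoothTransition.one_of_one_le hx, fun x hx => ?_⟩
  obtain ⟨c, hc⟩ : ∃ c : ℝ, Real.smoothTransition =ᶠ[𝓝 x] fun _ => c := by
    rw [Set.mem_Icc, not_and_or, not_le, not_le] at hx
    rcases hx with hx | hx
    · exact ⟨0, (eventually_lt_nhds hx).mono fun y hy =>
        Real.smoothTransition.zero_of_nonpos (le_of_lt hy)⟩
    · exact ⟨1, (eventually_gt_nhds hx).mono fun y hy =>
        Real.smoothTransition.one_of_one_le (le_of_lt hy)⟩
  have h1 : deriv Real.smoothTransition =ᶠ[𝓝 x] fun _ => 0 := by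
    have := hc.deriv
    simpa using this
  exact ⟨h1.self_of_nhds, by simpa using h1.deriv_eq⟩

/-- Let φ be the solution with data z at x₀. Then (H - k²)(χφ) = f = -(χ''φ + 2χ'φ') is compactly
supported, and the resolvent gives w in L² with the same image. So q = χφ - w solves the homogeneous
equation. Where χ = 1, φ - q = w is L² at +∞; where χ = 0, q = -w is L² at -∞. The data of φ - q and
q are the two summands. -/
theorem IsPeriodicPotential.exists_split (h : IsPeriodicPotential k L U) (hL : 0 < L)
    (hgap : ((k : ℂ) ^ 2) ∉ hamiltonianSpectrum U) (x₀ : ℝ) (z : Phase N) :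
    ∃ z₁ ∈ stable (transfer k (fun y => U (x₀ + y)) L),
      IntegrableOn (fun x => ‖(transfer k (fun y => U (x₀ + y)) (x - x₀) z₁).1‖ ^ 2) (Set.Ioi x₀) ∧
      ∃ z₂ ∈ stable (transfer k (fun y => U (x₀ + y)) (-L)), z₁ + z₂ = z := by
  have ht := h.translate x₀
  set Y := transfer k (fun y => U (x₀ + y)) with hY
  obtain ⟨G, hG⟩ := not_not.1 hgap
  obtain ⟨χ, χ', χ'', hχ, hχ', hχ''c, hχ0, hχ1, hχs⟩ := exists_cutoff
  have hχ'c : Continuous χ' := continuous_iff_continuousAt.2 fun x => (hχ' x).continuousAt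
  set φ : ℝ → Chan N := fun x => (Y (x - x₀) z).1 with hφ
  set φ' : ℝ → Chan N := fun x => (Y (x - x₀) z).2 with hφ'
  have hdφ : ∀ x, HasDerivAt φ (φ' x) x := fun x =>
    (ht.hasDerivAt_fst z (x - x₀)).comp_sub_const x x₀
  have hdφ' : ∀ x, HasDerivAt φ' (act (U x) (φ x) - (k : ℂ) ^ 2 • φ x) x := fun x => by
    have := (ht.hasDerivAt_snd z (x - x₀)).comp_sub_const x x₀
    rwa [add_sub_cancel] at this
  have hφc : Continuous φ := continuous_iff_continuousAt.2 fun x => (hdφ x).continuousAt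
  have hφ'c : Continuous φ' := continuous_iff_continuousAt.2 fun x => (hdφ' x).continuousAt
  set f : ℝ → Chan N := fun x => -(χ'' x • φ x + (2 : ℝ) • χ' x • φ' x) with hf
  have hfc : Continuous f := by fun_prop
  have hfs : HasCompactSupport f := by
    refine HasCompactSupport.of_support_subset_isCompact (isCompact_Icc (a := (0 : ℝ)) (b := 1)) ?_
    intro x hx
    by_contra hx2
    exact hx (by simp [hf, hχs x hx2])
  have hfm : MemLp f 2 := hfc.memLp_of_hasCompactSupport hfs
  obtain ⟨w, w', huw, hw, hw'⟩ := exists_classical_of_hamiltonianGraph h.cont hfc hfm.coeFn_toLp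
    ((hG (G (hfm.toLp f)) (hfm.toLp f)).2 rfl)
  have hwi := integrable_sq_of_ae_eq huw
  set q : ℝ → Chan N := fun x => χ x • φ x - w x with hq
  set q' : ℝ → Chan N := fun x => χ x • φ' x + χ' x • φ x - w' x with hq'
  have hdq : ∀ x, HasDerivAt q (q' x) x := fun x => ((hχ x).smul (hdφ x)).sub (hw x)
  have hdq' : ∀ x, HasDerivAt q' (act (U x) (q x) - (k : ℂ) ^ 2 • q x) x := fun x => by
    have h1 := (((hχ x).smul (hdφ' x)).add ((hχ' x).smul (hdφ x))).sub (hw' x)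
    refine h1.congr_deriv ?_
    simp only [hq, hf, ← actCLM_apply, map_sub]
    have e : actCLM (U x) (χ x • φ x) = χ x • actCLM (U x) (φ x) :=
      ((actCLM (U x)).restrictScalars ℝ).map_smul (χ x) (φ x)
    rw [e]
    simp only [smul_sub, smul_comm (χ x) ((k : ℂ) ^ 2)]
    module
  have hsol : ∀ y, q (x₀ + y) = (Y y (q x₀, q' x₀)).1 := by
    intro y
    have h2 := ht.eq_transfer (ψ := fun y => q (x₀ + y)) (ψ' := fun y => q' (x₀ + y))
      (fun y => (hdq (x₀ + y)).comp_const_add x₀ y) (fun y => (hdq' (x₀ + y)).comp_const_add x₀ y) y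
    simp only [add_zero] at h2
    exact congrArg Prod.fst h2
  have hsol1 : ∀ y, 1 ≤ x₀ + y → w (x₀ + y) = (Y y (z - (q x₀, q' x₀))).1 := by
    intro y hy
    rw [map_sub, Prod.fst_sub, ← hsol y]
    simp only [hq, hφ, hχ1 _ hy, one_smul, add_sub_cancel_left, sub_sub_cancel]
  refine ⟨z - (q x₀, q' x₀), ?_, ?_, (q x₀, q' x₀), ?_, sub_add_cancel _ _⟩
  · refine ht.mem_stable_of_integrable hL (f := w) (a := x₀) hwi.integrableOn ?_
    filter_upwards [eventually_ge_atTop (1 - x₀)] with y hy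
    exact hsol1 y (by linarith)
  · have hc : Continuous fun x => ‖(Y (x - x₀) (z - (q x₀, q' x₀))).1‖ ^ 2 :=
      ((continuous_fst.comp ((ht.continuous_transfer.comp
        (continuous_id.sub continuous_const)).clm_apply continuous_const)).norm.pow 2)
    have hsub : Set.Ioi x₀ ⊆ Set.Icc x₀ (max x₀ 1) ∪ Set.Ici (max x₀ 1) := fun x hx => by
      rcases le_total x (max x₀ 1) with h3 | h3
      · exact Or.inl ⟨le_of_lt hx, h3⟩
      · exact Or.inr h3
    refine IntegrableOn.mono_set (IntegrableOn.union
      (hc.continuousOn.integrableOn_compact isCompact_Icc) ?_) hsub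
    refine (hwi.integrableOn (s := Set.Ici (max x₀ 1))).congr_fun (fun x hx => ?_) measurableSet_Ici
    have h3 := hsol1 (x - x₀) (by
      rw [add_sub_cancel]; exact (le_max_right _ _).trans hx)
    rw [add_sub_cancel] at h3
    simp only [h3]
  · refine ht.mem_stable_neg_of_integrable hL (f := fun x => -w x) (a := x₀) ?_ ?_
    · simpa only [norm_neg] using hwi.integrableOn
    · filter_upwards [eventually_le_atBot (-x₀)] with y hy
      rw [← hsol y]
      simp only [hq, hχ0 _ (by linarith : x₀ + y ≤ 0), zero_smul, zero_sub]

/-- The consequences of a spectral gap for the transfer matrix over a period. -/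
structure IsHyperbolic (k L : ℝ) (U : ℝ → Matrix (Fin N) (Fin N) ℂ) : Prop where
  disjoint : Disjoint (stable (transfer k U L)) (stable (transfer k U (-L)))
  sup_eq_top : stable (transfer k U L) ⊔ stable (transfer k U (-L)) = ⊤
  finrank_stable : Module.finrank ℂ (stable (transfer k U L)) = N
  integrableOn : ∀ z ∈ stable (transfer k U L),
    IntegrableOn (fun y => ‖(transfer k U y z).1‖ ^ 2) (Set.Ioi 0)

theorem integrableOn_Ioi_comp_sub {f : ℝ → ℝ} (c : ℝ) :
    IntegrableOn (fun x => f (x - c)) (Set.Ioi c) ↔ IntegrableOn f (Set.Ioi 0) := by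
  have h := (measurePreserving_sub_right volume c).integrableOn_comp_preimage
    (MeasurableEquiv.subRight c).measurableEmbedding (f := f) (s := Set.Ioi 0)
  rwa [Set.preimage_sub_const_Ioi, zero_add] at h

/-- Two subspaces of dimension at most N that span dimension 2N have dimension N and meet in 0. The
splitting of stable data is then trivial, so they inherit the integrability of the first summand. -/
theorem IsPeriodicPotential.isHyperbolic_translate (h : IsPeriodicPotential k L U) (hL : 0 < L)
    (hk : 0 < k) (hgap : ((k : ℂ) ^ 2) ∉ hamiltonianSpectrum U) (x₀ : ℝ) :
    IsHyperbolic k L fun y => U (x₀ + y) := by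
  have hs := h.exists_split hL hgap x₀
  have ht := h.translate x₀
  set S := stable (transfer k (fun y => U (x₀ + y)) L) with hS
  set S' := stable (transfer k (fun y => U (x₀ + y)) (-L)) with hS'
  have hd1 : Module.finrank ℂ S ≤ N := finrank_le_of_flux hk fun z hz => ht.flux_eq_zero hz
  have hd2 : Module.finrank ℂ S' ≤ N := finrank_le_of_flux hk fun z hz => ht.neg.flux_eq_zero hz
  have htop : S ⊔ S' = ⊤ := by
    rw [eq_top_iff]
    intro z _
    obtain ⟨z₁, h1, -, z₂, h2, h3⟩ := hs z
    exact Submodule.mem_sup.2 ⟨z₁, h1, z₂, h2, h3⟩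
  have hdim := Submodule.finrank_sup_add_finrank_inf_eq S S'
  rw [htop, finrank_top, Module.finrank_prod, finrank_euclideanSpace_fin] at hdim
  have hinf : S ⊓ S' = ⊥ := Submodule.finrank_eq_zero.1 (by omega)
  refine ⟨disjoint_iff.2 hinf, htop, (by omega : Module.finrank ℂ S = N), fun z hz => ?_⟩
  obtain ⟨z₁, h1, h1', z₂, h2, h3⟩ := hs z
  have h4 : z₂ ∈ S ⊓ S' := ⟨by rw [← sub_eq_of_eq_add' h3.symm]; exact sub_mem hz h1, h2⟩
  rw [hinf, Submodule.mem_bot] at h4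
  rw [h4, add_zero] at h3
  rw [h3] at h1'
  exact (integrableOn_Ioi_comp_sub x₀).1 h1'

end Splitting

/-! ### Gluing functions at the truncation point. -/

section Glue

variable {E : Type*} {x₀ : ℝ} {f g f' g' : ℝ → E}

/-- The function equal to `f` on the left of `x₀` and to `g` on the right. -/
def glue (x₀ : ℝ) (f g : ℝ → E) (x : ℝ) : E := if x₀ ≤ x then g x else f x

theorem glue_of_le {x : ℝ} (h : x₀ ≤ x) : glue x₀ f g x = g x := if_pos h

theorem glue_of_lt {x : ℝ} (h : x < x₀) : glue x₀ f g x = f x := if_neg (not_le.2 h)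

theorem continuous_glue [TopologicalSpace E] (hf : Continuous f) (hg : Continuous g) (h : f x₀ = g x₀) :
    Continuous (glue x₀ f g) :=
  Continuous.if_le hg hf continuous_const continuous_id fun x hx => by rw [← hx, h]

variable [NormedAddCommGroup E] [NormedSpace ℝ E]

theorem hasDerivAt_glue (hf : ∀ x < x₀, HasDerivAt f (f' x) x)
    (hg : ∀ x, x₀ < x → HasDerivAt g (g' x) x) {x : ℝ} (hx : x ≠ x₀) :
    HasDerivAt (glue x₀ f g) (glue x₀ f' g' x) x := by
  rcases lt_or_gt_of_ne hx with h | h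
  · rw [glue_of_lt h]
    exact (hf x h).congr_of_eventuallyEq ((eventually_lt_nhds h).mono fun y hy => glue_of_lt hy)
  · rw [glue_of_le (le_of_lt h)]
    exact (hg x h).congr_of_eventuallyEq
      ((eventually_gt_nhds h).mono fun y hy => glue_of_le (le_of_lt hy))

theorem hasDerivAt_glue_of_continuous (hf : ∀ x < x₀, HasDerivAt f (f' x) x)
    (hg : ∀ x, x₀ < x → HasDerivAt g (g' x) x) (hfc : Continuous f) (hgc : Continuous g)
    (hfc' : Continuous f') (hgc' : Continuous g') (h : f x₀ = g x₀) (h' : f' x₀ = g' x₀) (x : ℝ) :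
    HasDerivAt (glue x₀ f g) (glue x₀ f' g' x) x := by
  rcases eq_or_ne x x₀ with rfl | hx
  · exact hasDerivAt_of_hasDerivAt_of_ne (fun y hy => hasDerivAt_glue hf hg hy)
      (continuous_glue hfc hgc h).continuousAt (continuous_glue hfc' hgc' h').continuousAt
  · exact hasDerivAt_glue hf hg hx

end Glue

/-! ### Scattering states and reflection matrices. -/

section Scattering

variable {N : ℕ} {k L : ℝ} {U : ℝ → Matrix (Fin N) (Fin N) ℂ} {x₀ : ℝ}

/-- The free wave with amplitudes `a`, `b` at `x₀`. -/
def planeWave (k x₀ : ℝ) (a b : Chan N) (x : ℝ) : Chan N :=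
  Complex.exp (Complex.I * k * (x - x₀)) • a + Complex.exp (-(Complex.I * k * (x - x₀))) • b

theorem planeWave_self (k x₀ : ℝ) (a b : Chan N) : planeWave k x₀ a b x₀ = a + b := by
  simp [planeWave]

theorem hasDerivAt_planeWave (k x₀ : ℝ) (a b : Chan N) (x : ℝ) :
    HasDerivAt (planeWave k x₀ a b)
      (planeWave k x₀ ((Complex.I * k) • a) (-((Complex.I * k) • b)) x) x := by
  have h0 : HasDerivAt (fun x : ℝ => Complex.I * k * ((x : ℂ) - x₀)) (Complex.I * k) x := by
    have := ((hasDerivAt_id x).ofReal_comp.sub_const (x₀ : ℂ)).const_mul (Complex.I * k)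
    simpa using this
  have h1 := h0.cexp.smul_const a
  have h2 := h0.neg.cexp.smul_const b
  refine (h1.add h2).congr_deriv ?_
  simp only [planeWave]
  module

theorem continuous_planeWave (k x₀ : ℝ) (a b : Chan N) : Continuous (planeWave k x₀ a b) :=
  continuous_iff_continuousAt.2 fun x => (hasDerivAt_planeWave k x₀ a b x).continuousAt

theorem act_zero_left (a : Chan N) : act (0 : Matrix (Fin N) (Fin N) ℂ) a = 0 := by
  simp [act]

/-- The scattering states are the continuations of the stable Cauchy data. -/
theorem exists_isScatteringState_iff (h : IsPeriodicPotential k L fun y => U (x₀ + y)) (hL : 0 < L)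
    (hyp : IsHyperbolic k L fun y => U (x₀ + y)) (a b : Chan N) :
    (∃ ψ, IsScatteringState U k x₀ a b ψ) ↔
      data k a b ∈ stable (transfer k (fun y => U (x₀ + y)) L) := by
  set Y := transfer k (fun y => U (x₀ + y)) with hY
  set z := data k a b with hz
  have hU : Continuous U := by
    have := h.cont.comp (continuous_id.sub (continuous_const (y := x₀)))
    refine this.congr fun x => ?_
    simp
  set φ : ℝ → Chan N := fun x => (Y (x - x₀) z).1 with hφ
  set φ' : ℝ → Chan N := fun x => (Y (x - x₀) z).2 with hφ'
  have hφ0 : φ x₀ = a + b := by simp [hφ, hY, transfer_zero, hz, data]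
  have hφ'0 : φ' x₀ = (Complex.I * k) • (a - b) := by simp [hφ', hY, transfer_zero, hz, data]
  have hdφ : ∀ x, HasDerivAt φ (φ' x) x := fun x =>
    (h.hasDerivAt_fst z (x - x₀)).comp_sub_const x x₀
  have hdφ' : ∀ x, HasDerivAt φ' (act (U x) (φ x) - (k : ℂ) ^ 2 • φ x) x := fun x => by
    have := (h.hasDerivAt_snd z (x - x₀)).comp_sub_const x x₀
    rwa [add_sub_cancel] at this
  have hφc : Continuous φ := continuous_iff_continuousAt.2 fun x => (hdφ x).continuousAt
  have hφ'c : Continuous φ' := continuous_iff_continuousAt.2 fun x => (hdφ' x).continuousAt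
  have hrhs : ∀ ψ : ℝ → Chan N, Continuous ψ →
      Continuous fun x => act (U x) (ψ x) - (k : ℂ) ^ 2 • ψ x := fun ψ hψ => by
    simp only [← actCLM_apply]
    have h1 : Continuous fun x => actCLM (U x) (ψ x) := (continuous_actCLM.comp hU).clm_apply hψ
    have h2 : Continuous fun x => (k : ℂ) ^ 2 • ψ x := by fun_prop
    exact Continuous.sub h1 h2
  set W := planeWave k x₀ a b with hW
  set W' := planeWave k x₀ ((Complex.I * k) • a) (-((Complex.I * k) • b)) with hW'
  have hW0 : W x₀ = a + b := planeWave_self _ _ _ _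
  have hW'0 : W' x₀ = (Complex.I * k) • (a - b) := by
    rw [hW', planeWave_self, smul_sub, ← sub_eq_add_neg]
  have hWc : Continuous W := continuous_planeWave _ _ _ _
  have hW'c : Continuous W' := continuous_planeWave _ _ _ _
  constructor
  · rintro ⟨ψ, ⟨ψ', hψ'c, hdψ, hdψ'⟩, hL2, hleft⟩
    have hψc : Continuous ψ := continuous_iff_continuousAt.2 fun x => (hdψ x).continuousAt
    have hcl : x₀ ∈ closure (Set.Iio x₀) := by rw [closure_Iio]; exact Set.mem_Iic.2 le_rfl
    have he : Set.EqOn ψ W (Set.Iio x₀) := fun x hx => hleft x hx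
    have he' : Set.EqOn ψ' W' (Set.Iio x₀) := fun x hx =>
      (hdψ x).unique ((hasDerivAt_planeWave k x₀ a b x).congr_of_eventuallyEq
        ((eventually_lt_nhds hx).mono fun y hy => he hy))
    have h0 : φ x₀ = ψ x₀ := by rw [hφ0, he.closure hψc hWc hcl, hW0]
    have h0' : φ' x₀ = ψ' x₀ := by rw [hφ'0, he'.closure hψ'c hW'c hcl, hW'0]
    -- ψ solves the equation with U only to the right of x₀. Replacing its left half by φ, which has
    -- the same Cauchy data there, gives a global solution, to which uniqueness applies.
    have hd1 := hasDerivAt_glue_of_continuous (fun x _ => hdφ x) (fun x _ => hdψ x) hφc hψc hφ'c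
      hψ'c h0 h0'
    have hd2 := hasDerivAt_glue_of_continuous (x₀ := x₀) (f := φ') (g := ψ')
      (g' := fun x => act (U x) (ψ x) - (k : ℂ) ^ 2 • ψ x) (fun x _ => hdφ' x)
      (fun x hx => by
        have := hdψ' x (ne_of_gt hx)
        rwa [truncate, if_pos (le_of_lt hx)] at this)
      hφ'c hψ'c (hrhs φ hφc) (hrhs ψ hψc) h0' (by simp only [h0])
    have hd2' : ∀ x, HasDerivAt (glue x₀ φ' ψ')
        (act (U x) (glue x₀ φ ψ x) - (k : ℂ) ^ 2 • glue x₀ φ ψ x) x := fun x => by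
      refine (hd2 x).congr_deriv ?_
      rcases lt_or_ge x x₀ with hx | hx
      · simp only [glue_of_lt hx]
      · simp only [glue_of_le hx]
    have hsol : ∀ y, 0 ≤ y → ψ (x₀ + y) = (Y y z).1 := by
      intro y hy
      have h2 := h.eq_transfer (ψ := fun y => glue x₀ φ ψ (x₀ + y))
        (ψ' := fun y => glue x₀ φ' ψ' (x₀ + y))
        (fun y => (hd1 (x₀ + y)).comp_const_add x₀ y)
        (fun y => (hd2' (x₀ + y)).comp_const_add x₀ y) y
      have h3 : ((glue x₀ φ ψ x₀, glue x₀ φ' ψ' x₀) : Phase N) = z := by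
        rw [glue_of_le le_rfl, glue_of_le le_rfl, ← h0, ← h0', hφ0, hφ'0]; rfl
      simp only [add_zero, h3] at h2
      have h4 := congrArg Prod.fst h2
      simpa only [glue_of_le (le_add_of_nonneg_right hy)] using h4
    refine h.mem_stable_of_integrable hL (f := ψ) (a := x₀)
      ((memLp_two_iff_integrable_sq_norm hL2.1).1 hL2) ?_
    filter_upwards [eventually_ge_atTop 0] with y hy using hsol y hy
  · intro hmem
    refine ⟨glue x₀ W φ, ⟨glue x₀ W' φ', continuous_glue hW'c hφ'c (hW'0.trans hφ'0.symm),
      hasDerivAt_glue_of_continuous (fun x _ => hasDerivAt_planeWave k x₀ a b x) (fun x _ => hdφ x)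
        hWc hφc hW'c hφ'c (hW0.trans hφ0.symm) (hW'0.trans hφ'0.symm), fun x hx => ?_⟩, ?_,
      fun x hx => glue_of_lt hx⟩
    · refine (hasDerivAt_glue (fun x _ => hasDerivAt_planeWave k x₀ _ _ x)
        (fun x _ => hdφ' x) hx).congr_deriv ?_
      rcases lt_or_ge x x₀ with hx | hx
      · rw [glue_of_lt hx, glue_of_lt hx, truncate, if_neg (not_le.2 hx), act_zero_left]
        simp only [hW, planeWave, smul_neg, smul_smul, zero_sub]
        have e : Complex.I * k * (Complex.I * k) = -(k : ℂ) ^ 2 := by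
          linear_combination ((k : ℂ) ^ 2) * Complex.I_mul_I
        rw [e]
        module
      · rw [glue_of_le hx, glue_of_le hx, truncate, if_pos hx]
    · have hc := continuous_glue hWc hφc (hW0.trans hφ0.symm)
      refine (memLp_two_iff_integrable_sq_norm hc.aestronglyMeasurable).2 ?_
      refine IntegrableOn.congr_fun ((integrableOn_Ioi_comp_sub x₀).2 (hyp.integrableOn z hmem))
        (fun x hx => ?_) measurableSet_Ioi
      simp only [glue_of_le (le_of_lt hx), hφ, hY]

/-- A half-dimensional space of Cauchy data without flux is the graph of a reflection matrix. -/
theorem exists_reflection_of_flux (hk : 0 < k) {S : Submodule ℂ (Phase N)}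
    (hS : ∀ z ∈ S, flux z = 0) (hdim : Module.finrank ℂ S = N) :
    ∃ R : Matrix (Fin N) (Fin N) ℂ, ∀ a b, data k a b ∈ S ↔ b = act R a := by
  have hinj := incoming_injOn hk hS
  have hsurj : Function.Surjective ((incoming k).domRestrict S) :=
    (LinearMap.injective_iff_surjective_of_finrank_eq_finrank (by simp [hdim])).1 hinj
  let e := LinearEquiv.ofBijective _ ⟨hinj, hsurj⟩
  -- Incoming amplitudes parametrize S bijectively, by the dimension count; the reflection map reads
  -- off the outgoing amplitude.
  let T : Chan N →ₗ[ℂ] Chan N := outgoing k ∘ₗ S.subtype ∘ₗ e.symm.toLinearMap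
  have hT : ∀ a, act (Matrix.toEuclideanLin.symm T) a = T a := fun a =>
    congrArg (fun F : Chan N →ₗ[ℂ] Chan N => F a) (Matrix.toEuclideanLin.apply_symm_apply T)
  have he : ∀ z : S, incoming k z = e z := fun _ => rfl
  refine ⟨Matrix.toEuclideanLin.symm T, fun a b => ?_⟩
  rw [hT]
  constructor
  · intro hm
    have h1 : e ⟨data k a b, hm⟩ = a := by rw [← he]; exact incoming_data hk.ne' a b
    have h2 : e.symm a = ⟨data k a b, hm⟩ := e.symm_apply_eq.2 h1.symm
    change b = outgoing k (e.symm a : S)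
    rw [h2]
    exact (outgoing_data hk.ne' a b).symm
  · rintro rfl
    have h1 : incoming k (e.symm a : S) = a := by rw [he, e.apply_symm_apply]
    have h2 := data_incoming_outgoing hk.ne' (e.symm a : S).1
    rw [h1] at h2
    change data k a (outgoing k (e.symm a : S)) ∈ S
    rw [h2]
    exact (e.symm a).2

/-- A closed graph allows only f x as a cluster value at x, and compactness turns this into
convergence. It is applied to R a, confined to a ball because R preserves norms. -/
theorem continuous_of_isClosed_graph {X Z : Type*} [TopologicalSpace X] [TopologicalSpace Z]
    {f : X → Z} {s : Set Z} (hs : IsCompact s) (hfs : ∀ x, f x ∈ s)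
    (hf : IsClosed {p : X × Z | p.2 = f p.1}) : Continuous f := by
  refine continuous_iff_continuousAt.2 fun x => ?_
  refine hs.tendsto_nhds_of_unique_mapClusterPt (Eventually.of_forall hfs) fun y _ hy => ?_
  by_contra hne
  have h1 : {p : X × Z | p.2 = f p.1}ᶜ ∈ 𝓝 (x, y) := hf.isOpen_compl.mem_nhds hne
  obtain ⟨A, hA, B, hB, hAB⟩ := mem_nhds_prod_iff.1 h1
  obtain ⟨x', hx', hx''⟩ := ((hy.frequently hB).and_eventually hA).exists
  exact hAB (Set.mk_mem_prod hx'' hx') rfl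

end Scattering

/-! ### Continuous logarithms on the plane and their increments. -/

section Winding

/-- A zero-free continuous function on the plane has a continuous logarithm. -/
theorem exists_continuous_log {f : ℝ × ℝ → ℂ} (hf : Continuous f) (h0 : ∀ p, f p ≠ 0) :
    ∃ l : ℝ × ℝ → ℂ, Continuous l ∧ ∀ p, f p = Complex.exp (l p) := by
  obtain ⟨F, hF, -⟩ := Complex.isCoveringMapOn_exp.existsUnique_continuousMap_lifts
    (⟨f, hf⟩ : C(ℝ × ℝ, ℂ)) (a₀ := (0 : ℝ × ℝ)) (e₀ := Complex.log (f 0))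
    (Complex.exp_log (h0 0)) h0
  exact ⟨F, F.continuous, fun p => (congrFun hF.2 p).symm⟩

/-- A continuous logarithm of a periodic function increases by a constant over a period. -/
theorem exists_log_increment {l : ℝ × ℝ → ℂ} (hl : Continuous l) (c : ℝ × ℝ)
    (h : ∀ p, Complex.exp (l (p + c)) = Complex.exp (l p)) :
    ∃ w : ℤ, ∀ p, l (p + c) = l p + 2 * Real.pi * Complex.I * w := by
  choose j hj using fun p => Complex.exp_eq_exp_iff_exists_int.1 (h p)
  have hr : ∀ p, ((j p : ℤ) : ℝ) = (l (p + c) - l p).im / (2 * Real.pi) := by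
    intro p
    rw [hj p, eq_div_iff (by positivity)]
    simp
  -- The increment divided by 2πi is continuous and integer-valued, hence constant on the connected
  -- plane.
  have hc : Continuous j := by
    rw [Int.isClosedEmbedding_coe_real.isInducing.continuous_iff]
    have : ((fun i : ℤ => (i : ℝ)) ∘ j) = fun p => (l (p + c) - l p).im / (2 * Real.pi) := funext hr
    rw [this]
    fun_prop
  refine ⟨j 0, fun p => ?_⟩
  rw [hj p, PreconnectedSpace.constant inferInstance hc (x := p) (y := 0)]
  ring

theorem log_increment_int_mul {l : ℝ × ℝ → ℂ} {c : ℝ × ℝ} {d : ℂ}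
    (h : ∀ p, l (p + c) = l p + d) (n : ℤ) (p : ℝ × ℝ) : l (p + n • c) = l p + n * d := by
  induction n using Int.induction_on generalizing p with
  | zero => simp
  | succ i ih =>
    rw [add_smul, one_smul, ← add_assoc, h, ih]
    push_cast
    ring
  | pred i ih =>
    have h1 := h (p + (-(i : ℤ) - 1) • c)
    have h2 : p + (-(i : ℤ) - 1) • c + c = p + (-(i : ℤ)) • c := by module
    rw [h2, ih] at h1
    rw [eq_sub_of_add_eq h1.symm]
    push_cast
    ring

end Winding

/-! ### Continuity of the reflection matrix in (x, s). -/

section Family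

variable {N : ℕ} {V : ℝ → ℝ → Matrix (Fin N) (Fin N) ℂ} {T L k : ℝ}

theorem exists_bound_of_doubly_periodic {f : ℝ → ℝ → ℝ} (hf : Continuous fun p : ℝ × ℝ => f p.1 p.2)
    (hT : 0 < T) (hL : 0 < L) (hperT : ∀ x s, f x (s + T) = f x s)
    (hperL : ∀ x s, f (x + L) s = f x s) : ∃ K, ∀ x s, f x s ≤ K := by
  obtain ⟨K, hK⟩ := ((isCompact_Icc (a := (0 : ℝ)) (b := L)).prod
    (isCompact_Icc (a := (0 : ℝ)) (b := T))).bddAbove_image hf.continuousOn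
  refine ⟨K, fun x s => ?_⟩
  obtain ⟨x', hx', hx⟩ := Function.Periodic.exists_mem_Ico₀ (f := fun x => f x s)
    (fun x => hperL x s) hL x
  obtain ⟨s', hs', hs⟩ := Function.Periodic.exists_mem_Ico₀ (f := f x') (hperT x') hT s
  have h1 : f x s = f x' s' := hx.trans hs
  rw [h1]
  exact hK (Set.mem_image_of_mem (fun p : ℝ × ℝ => f p.1 p.2)
    (Set.mk_mem_prod (Set.Ico_subset_Icc_self hx') (Set.Ico_subset_Icc_self hs')))

theorem exists_generator_bound (hcont : Continuous fun p : ℝ × ℝ => V p.1 p.2) (hT : 0 < T)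
    (hL : 0 < L) (hperT : ∀ x s, V x (s + T) = V x s) (hperL : ∀ x s, V (x + L) s = V x s) :
    ∃ K, ∀ x s, ‖generator k (V x s)‖ ≤ K :=
  exists_bound_of_doubly_periodic (f := fun x s => ‖generator k (V x s)‖)
    ((continuous_generator k).comp hcont).norm hT hL (fun x s => by rw [hperT])
    fun x s => by rw [hperL]

theorem isPeriodicPotential_slice (hcont : Continuous fun p : ℝ × ℝ => V p.1 p.2)
    (hherm : ∀ x s, (V x s).IsHermitian) (hT : 0 < T) (hL : 0 < L)
    (hperT : ∀ x s, V x (s + T) = V x s) (hperL : ∀ x s, V (x + L) s = V x s) (s : ℝ) :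
    IsPeriodicPotential k L fun x => V x s where
  cont := hcont.comp (continuous_id.prodMk continuous_const)
  herm x := hherm x s
  bdd := (exists_generator_bound hcont hT hL hperT hperL).imp fun _ hK x => hK x s
  per x := hperL x s

theorem continuous_clm_propagator {X F : Type*} [TopologicalSpace X] [FirstCountableTopology X]
    [NormedAddCommGroup F] [NormedSpace ℂ F] [CompleteSpace F] {A : X → ℝ → F →L[ℂ] F}
    (hA : Continuous fun p : X × ℝ => A p.1 p.2) {K : ℝ} (hK : ∀ x t, ‖A x t‖ ≤ K) (t : ℝ) :
    Continuous fun x => propagator (A x) t :=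
  (continuous_propagator hA hK).comp (by fun_prop : Continuous fun x => (x, t))

theorem continuous_transfer_of_bound {X : Type*} [TopologicalSpace X] [FirstCountableTopology X]
    {U : X → ℝ → Matrix (Fin N) (Fin N) ℂ} (hU : Continuous fun q : X × ℝ => U q.1 q.2) {K : ℝ}
    (hK : ∀ x y, ‖generator k (U x y)‖ ≤ K) (y : ℝ) : Continuous fun x => transfer k (U x) y := by
  have h1 : Continuous fun q : X × ℝ => generator k (U q.1 q.2) := (continuous_generator k).comp hU
  exact continuous_clm_propagator (A := fun x y => generator k (U x y)) h1 hK y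

theorem continuous_transfer_family (hcont : Continuous fun p : ℝ × ℝ => V p.1 p.2) (hT : 0 < T)
    (hL : 0 < L) (hperT : ∀ x s, V x (s + T) = V x s) (hperL : ∀ x s, V (x + L) s = V x s) :
    Continuous fun p : ℝ × ℝ => transfer k (fun y => V (p.1 + y) p.2) L := by
  obtain ⟨K, hK⟩ := exists_generator_bound (k := k) hcont hT hL hperT hperL
  have h1 : Continuous fun q : (ℝ × ℝ) × ℝ => (q.1.1 + q.2, q.1.2) := by fun_prop
  exact continuous_transfer_of_bound (U := fun (p : ℝ × ℝ) y => V (p.1 + y) p.2) (hcont.comp h1)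
    (fun p y => hK _ _) L

theorem norm_act_reflection (hk : 0 < k) {S : Submodule ℂ (Phase N)} (hS : ∀ z ∈ S, flux z = 0)
    {R : Matrix (Fin N) (Fin N) ℂ} (hR : ∀ a b, data k a b ∈ S ↔ b = act R a) (a : Chan N) :
    ‖act R a‖ = ‖a‖ := by
  have h := norm_incoming_eq hk (hS _ ((hR a _).2 rfl))
  rwa [incoming_data hk.ne', outgoing_data hk.ne'] at h

theorem det_ne_zero_of_norm_act {R : Matrix (Fin N) (Fin N) ℂ} (hR : ∀ a, ‖act R a‖ = ‖a‖) :
    R.det ≠ 0 := by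
  intro h0
  obtain ⟨v, hv, hv0⟩ := Matrix.exists_mulVec_eq_zero_iff.2 h0
  have h1 := hR (WithLp.toLp 2 v)
  have h2 : act R (WithLp.toLp 2 v) = 0 := by
    change WithLp.toLp 2 (R.mulVec v) = 0
    rw [hv0]; rfl
  rw [h2, norm_zero, eq_comm, norm_eq_zero] at h1
  exact hv ((WithLp.toLp_eq_zero 2).1 h1)

theorem continuous_of_continuous_act {X : Type*} [TopologicalSpace X]
    {R : X → Matrix (Fin N) (Fin N) ℂ} (h : ∀ a, Continuous fun x => act (R x) a) :
    Continuous R := by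
  refine continuous_matrix fun i j => ?_
  have h1 := (EuclideanSpace.proj (𝕜 := ℂ) i).continuous.comp (h (EuclideanSpace.single j 1))
  refine h1.congr fun x => ?_
  simp [act]

/-- The reflection matrices of a periodic family of gapped potentials form a continuous family. -/
theorem exists_continuous_reflection (hcont : Continuous fun p : ℝ × ℝ => V p.1 p.2)
    (hherm : ∀ x s, (V x s).IsHermitian) (hT : 0 < T) (hL : 0 < L)
    (hperT : ∀ x s, V x (s + T) = V x s) (hperL : ∀ x s, V (x + L) s = V x s) (hk : 0 < k)
    (hgap : ∀ s, ((k : ℂ) ^ 2) ∉ hamiltonianSpectrum fun x => V x s) :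
    ∃ R : ℝ × ℝ → Matrix (Fin N) (Fin N) ℂ, Continuous R ∧ (∀ p, (R p).det ≠ 0) ∧
      -- Only the potential seen from the truncation point matters; this form covers translation by
      -- periods and the moving frame alike.
      ∀ (p : ℝ × ℝ) (U : ℝ → Matrix (Fin N) (Fin N) ℂ) (x₀ : ℝ),
        (∀ y, U (x₀ + y) = V (p.1 + y) p.2) → IsReflectionMatrix U k x₀ (R p) := by
  have hpot : ∀ p : ℝ × ℝ, IsPeriodicPotential k L fun y => V (p.1 + y) p.2 := fun p =>
    (isPeriodicPotential_slice hcont hherm hT hL hperT hperL p.2).translate p.1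
  have hhyp : ∀ p : ℝ × ℝ, IsHyperbolic k L fun y => V (p.1 + y) p.2 := fun p =>
    (isPeriodicPotential_slice hcont hherm hT hL hperT hperL p.2).isHyperbolic_translate hL hk
      (hgap p.2) p.1
  have hflux : ∀ p : ℝ × ℝ, ∀ z ∈ stable (transfer k (fun y => V (p.1 + y) p.2) L), flux z = 0 :=
    fun p z hz => (hpot p).flux_eq_zero hz
  choose R hR using fun p : ℝ × ℝ =>
    exists_reflection_of_flux hk (hflux p) (hhyp p).finrank_stable
  have hnorm : ∀ p a, ‖act (R p) a‖ = ‖a‖ := fun p a => norm_act_reflection hk (hflux p) (hR p) a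
  have hgraph := isClosed_stable_graph
    (M' := fun p : ℝ × ℝ => transfer k (fun y => V (p.1 + y) p.2) (-L))
    (continuous_transfer_family (k := k) hcont hT hL hperT hperL)
    (fun p => (hpot p).transfer_mul_neg) (fun p => (hpot p).transfer_neg_mul)
    (fun p => (hhyp p).disjoint) (fun p => (hhyp p).sup_eq_top)
  refine ⟨R, continuous_of_continuous_act fun a => ?_, fun p => det_ne_zero_of_norm_act (hnorm p),
    fun p U x₀ hU a b => ?_⟩
  · refine continuous_of_isClosed_graph (isCompact_closedBall (0 : Chan N) ‖a‖)
      (fun p => by rw [mem_closedBall_zero_iff, hnorm]) ?_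
    have hc : Continuous fun q : (ℝ × ℝ) × Chan N => (q.1, data k a q.2) := by
      unfold data
      fun_prop
    convert hgraph.preimage hc using 1
    ext q
    exact (hR q.1 a q.2).symm
  · have hU' : (fun y => U (x₀ + y)) = fun y => V (p.1 + y) p.2 := funext hU
    rw [exists_isScatteringState_iff (hU' ▸ hpot p) hL (hU' ▸ hhyp p), hU', hR p]

end Family

end QuantumPump

end

/-! ### The transformation law. -/

theorem theorem4p3 {N : ℕ} (V : ℝ → ℝ → Matrix (Fin N) (Fin N) ℂ)
    (hcont : Continuous fun p : ℝ × ℝ => V p.1 p.2)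
    (hherm : ∀ x s, (V x s).IsHermitian)
    (T L : ℝ) (hT : 0 < T) (hL : 0 < L)
    (hperT : ∀ x s, V x (s + T) = V x s)
    (hperL : ∀ x s, V (x + L) s = V x s)
    (k : ℝ) (hk : 0 < k)
    (hgap : ∀ s, ((k : ℂ) ^ 2) ∉ QuantumPump.hamiltonianSpectrum (fun x => V x s))
    (v : ℝ) (n m : ℤ) (hv : v * (n * T) = m * L) :
    ∃ (R R' : ℝ → ℝ → Matrix (Fin N) (Fin N) ℂ) (Wx Ws Wx' Ws' : ℤ),
      -- `R x s`, `R' x s` are the reflection matrices at truncation point `x` and time `s`,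
      -- in the original frame and in the boosted frame
      (∀ x s, QuantumPump.IsReflectionMatrix (fun y => V y s) k x (R x s)) ∧
      (∀ x s, QuantumPump.IsReflectionMatrix (fun y => QuantumPump.boost V v y s) k x (R' x s)) ∧
      -- the winding numbers with respect to the periods `(T, L)` in the original frame
      (∀ x, QuantumPump.HasWindingNumber (fun s => (R x s).det) T Wx) ∧
      (∀ s, QuantumPump.HasWindingNumber (fun x => (R x s).det) L Ws) ∧
      -- the winding numbers with respect to the periods `(n T, m L)` in the boosted frame
      (∀ x, QuantumPump.HasWindingNumber (fun s => (R' x s).det) (n * T) Wx') ∧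
      (∀ s, QuantumPump.HasWindingNumber (fun x => (R' x s).det) (m * L) Ws') ∧
      -- the transformation law
      Wx' = n * Wx + m * Ws ∧
      Ws' = m * Ws := by
  obtain ⟨R, hRc, hRd, hR⟩ := QuantumPump.exists_continuous_reflection hcont hherm hT hL hperT
    hperL hk hgap
  obtain ⟨l, hl, hle⟩ := QuantumPump.exists_continuous_log hRc.matrix_det hRd
  -- Both points see the same potential, so uniqueness of the reflection matrix gives periodicity.
  have hRT : ∀ p, R (p + (0, T)) = R p := fun p =>
    (hR (p + (0, T)) (fun y => V y p.2) p.1 fun y => by simp [hperT]).unique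
      (hR p (fun y => V y p.2) p.1 fun y => rfl)
  have hRL : ∀ p, R (p + (L, 0)) = R p := fun p =>
    (hR (p + (L, 0)) (fun y => V y p.2) p.1 fun y => by
      simp [add_right_comm _ L y, hperL]).unique (hR p (fun y => V y p.2) p.1 fun y => rfl)
  obtain ⟨Wx, hWx⟩ := QuantumPump.exists_log_increment hl (0, T) fun p => by
    rw [← hle, ← hle, hRT]
  obtain ⟨Ws, hWs⟩ := QuantumPump.exists_log_increment hl (L, 0) fun p => by
    rw [← hle, ← hle, hRL]
  have hWxn := QuantumPump.log_increment_int_mul hWx n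
  have hWsm := QuantumPump.log_increment_int_mul hWs m
  refine ⟨fun x s => R (x, s), fun x s => R (x + v * s, s), Wx, Ws, n * Wx + m * Ws, m * Ws,
    fun x s => hR (x, s) _ x fun y => rfl, fun x s => hR (x + v * s, s) _ x fun y => ?_,
    fun x => ⟨fun s => l (x, s), by fun_prop, fun s => hle _, fun s => ?_⟩,
    fun s => ⟨fun x => l (x, s), by fun_prop, fun x => hle _, fun x => ?_⟩,
    fun x => ⟨fun s => l (x + v * s, s), by fun_prop, fun s => hle _, fun s => ?_⟩,
    fun s => ⟨fun x => l (x + v * s, s), by fun_prop, fun x => hle _, fun x => ?_⟩, rfl, rfl⟩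
  · rw [QuantumPump.boost]
    congr 1
    ring
  · simpa using hWx (x, s)
  · simpa using hWs (x, s)
  -- The first coordinate moves by v·nT, which is mL by `hv`: a lattice displacement.
  · have e : (x + v * (s + n * T), s + n * T) = (x + v * s, s) + n • (0, T) + m • (L, 0) := by
      ext <;> simp
      linear_combination hv
    simp only
    rw [e, hWsm, hWxn]
    push_cast
    ring
  · have e : (x + m * L + v * s, s) = (x + v * s, s) + m • (L, 0) := by
      ext <;> simp
      ring
    simp only
    rw [e, hWsm]
    push_cast
    ring
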